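/- Let $H$ be a complex Hilbert space of finite dimension $N$, let $A$ be a self-adjoint operator on $H$, and let $e\in H$ be a unit vector that is cyclic for $A$, i.e. $H$ is the linear span of $\{A^n e : n=0,1,2,\ldots\}$. Put $Bf=\langle f,e\rangle e$ (inner product linear in the first variable), $A_\gamma=A+\gamma B$ for $\gamma\in\mathbf{C}$, and, for $\theta\in(0,\pi)$, $$S_\theta=\bigcup_{t>0}\mathrm{Spec}\left(A_{te^{i\theta}}\right).$$ Let $\lambda_1,\ldots,\lambda_N$ be the eigenvalues of $A$ in increasing order, let $\delta_1,\ldots,\delta_{N-1}$ be the eigenvalues, in increasing order, of the truncation of $A$ to $\{f:\langle f,e\rangle=0\}$, and put $\delta_N=\infty$. A simple analytic curve is an injective real analytic map $\sigma:(0,\infty)\to\mathbf{C}_+=\{z:\mathrm{Im}\, z>0\}$ with $\sigma'(t)\neq0$ for all $t>0$; it starts at $\lim_{t\to0+}\sigma(t)$ and ends at $\lim_{t\to\infty}\sigma(t)\in\mathbf{C}\cup\{\infty\}$. Then there exists a finite set $T\subset(0,\pi)$ such that, for every $\theta\in(0,\pi)\setminus T$, the set $S_\theta$ is the union of $N$ pairwise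 disjoint simple analytic curves $\sigma_1,\ldots,\sigma_N$, where $\sigma_r$ starts at $\lambda_r$ and ends at $\delta_{\tau_\theta(r)}$ for some permutation $\tau_\theta$ of $\{1,\ldots,N\}$. The permutation $\tau_\theta$ is uniquely determined by $\theta$ (it is the same for every such decomposition of $S_\theta$), and it is constant as a function of $\theta$ on each subinterval of $(0,\pi)\setminus T$. The permutation may change from one such interval to another: there are a self-adjoint operator $A$ on $\mathbf{C}^2$ and a cyclic unit vector $e$ for $A$ such that, for every set $T$ as above, there exist $\theta,\phi\in(0,\pi)\setminus T$ with $\tau_\theta\neq\tau_\phi$. -/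

import Mathlib

open Set Filter Topology Module

noncomputable section

namespace RankOnePerturbation

variable {H : Type*} [NormedAddCommGroup H] [InnerProductSpace ℂ H]

/-- `e` is a cyclic unit vector for the operator `A` on a finite-dimensional space: it has norm one
and the linear span of `e, A e, A² e, …` is the whole space. -/
structure IsCyclicVector (A : H →ₗ[ℂ] H) (e : H) : Prop where
  norm_eq_one : ‖e‖ = 1
  span_eq_top : Submodule.span ℂ (range fun n : ℕ => ((A : Module.End ℂ H) ^ n) e) = ⊤

/-- The operator `B f = ⟨f, e⟩ e` (Mathlib's inner product is linear in the second slot, so that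
the coefficient `⟨f, e⟩`, which is linear in `f`, is `inner ℂ e f`). -/
def rankOneOp (e : H) : H →ₗ[ℂ] H := (InnerProductSpace.rankOne ℂ e e : H →L[ℂ] H)

theorem rankOneOp_apply (e f : H) : rankOneOp e f = inner ℂ e f • e := rfl

/-- The perturbed operator `A_γ = A + γ B`. -/
def perturbed (A : H →ₗ[ℂ] H) (e : H) (γ : ℂ) : H →ₗ[ℂ] H := A + γ • rankOneOp e

/-- `S_θ = ⋃_{t > 0} Spec (A_{t e^{iθ}})`. -/
def spectralSet (A : H →ₗ[ℂ] H) (e : H) (θ : ℝ) : Set ℂ :=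
  ⋃ t ∈ Ioi (0 : ℝ),
    spectrum ℂ (perturbed A e ((t : ℂ) * Complex.exp ((θ : ℂ) * Complex.I)) : Module.End ℂ H)

/-- The truncation of `A` to the subspace `K`: `f ↦ P_K (A f)`, `f ∈ K`. -/
def truncation (A : H →ₗ[ℂ] H) (K : Submodule ℂ H) [K.HasOrthogonalProjection] : K →ₗ[ℂ] K :=
  (K.orthogonalProjectionOnto : H →ₗ[ℂ] K) ∘ₗ A ∘ₗ K.subtype

theorem truncation_isSymmetric {A : H →ₗ[ℂ] H} (hA : A.IsSymmetric) (K : Submodule ℂ H)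
    [K.HasOrthogonalProjection] : (truncation A K).IsSymmetric := by
  intro x y
  have h1 : inner ℂ (truncation A K x) y = inner ℂ (A x) (y : H) := by
    simp [truncation]
  have h2 : inner ℂ x (truncation A K y) = inner ℂ (x : H) (A y) := by
    simp [truncation]
  rw [h1, h2]
  exact hA x y

/-- The eigenvalues of a symmetric operator, repeated according to multiplicity and written in
increasing order (Mathlib lists them in decreasing order). -/
def incEigenvalues {V : Type*} [NormedAddCommGroup V] [InnerProductSpace ℂ V]
    [FiniteDimensional ℂ V] {T : V →ₗ[ℂ] V} (hT : T.IsSymmetric) (r : Fin (finrank ℂ V)) : ℝ :=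
  hT.eigenvalues rfl r.rev

/-- The points `δ_1 ≤ … ≤ δ_{N-1}`, the eigenvalues of the truncation of `A` to
`{f : ⟨f, e⟩ = 0}` (which has dimension `N - 1` if `e ≠ 0`), followed by `δ_N = ∞`, as points of
the Riemann sphere. -/
def endPoint [FiniteDimensional ℂ H] {A : H →ₗ[ℂ] H} (hA : A.IsSymmetric) (e : H)
    (r : Fin (finrank ℂ H)) : OnePoint ℂ :=
  if h : (r : ℕ) < finrank ℂ ((Submodule.span ℂ {e})ᗮ : Submodule ℂ H) then
    (((incEigenvalues (truncation_isSymmetric hA (Submodule.span ℂ {e})ᗮ) ⟨r, h⟩ : ℝ) : ℂ) :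
      OnePoint ℂ)
  else OnePoint.infty

/-- `σ : (0, ∞) → ℂ₊` is a simple analytic curve: it is injective and real analytic, and its
derivative vanishes nowhere. (Only the values of `σ` on `(0, ∞)` matter.) -/
structure IsSimpleAnalyticCurve (σ : ℝ → ℂ) : Prop where
  im_pos : ∀ t ∈ Ioi (0 : ℝ), 0 < (σ t).im
  injOn : InjOn σ (Ioi 0)
  analytic : AnalyticOnNhd ℝ σ (Ioi 0)
  deriv_ne_zero : ∀ t ∈ Ioi (0 : ℝ), deriv σ t ≠ 0

/-- `S_θ` is the union of `N` pairwise disjoint simple analytic curves, the `r`-th of which starts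
at the `r`-th eigenvalue `λ_r` of `A` and ends at `δ_{ρ r}`. -/
def IsSpectralPermutation [FiniteDimensional ℂ H] {A : H →ₗ[ℂ] H} (hA : A.IsSymmetric) (e : H)
    (θ : ℝ) (ρ : Equiv.Perm (Fin (finrank ℂ H))) : Prop :=
  ∃ σ : Fin (finrank ℂ H) → ℝ → ℂ,
    (∀ r, IsSimpleAnalyticCurve (σ r)) ∧
    (∀ r s, r ≠ s → Disjoint (σ r '' Ioi 0) (σ s '' Ioi 0)) ∧
    spectralSet A e θ = ⋃ r, σ r '' Ioi 0 ∧
    (∀ r, Tendsto (σ r) (𝓝[>] 0) (𝓝 ((incEigenvalues hA r : ℝ) : ℂ))) ∧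
    ∀ r, Tendsto (fun t => (σ r t : OnePoint ℂ)) atTop (𝓝 (endPoint hA e (ρ r)))

/-- `T` is a finite subset of `(0, π)` such that for every `θ ∈ (0, π) \ T` the set `S_θ` is the
union of `N` disjoint simple analytic curves that join `λ_r` to `δ_{τ θ r}`; the permutation `τ θ`
is determined by `θ`, and it is constant on each subinterval of `(0, π) \ T`. -/
structure IsSpectralDecomposition [FiniteDimensional ℂ H] {A : H →ₗ[ℂ] H} (hA : A.IsSymmetric)
    (e : H) (T : Set ℝ) (τ : ℝ → Equiv.Perm (Fin (finrank ℂ H))) : Prop where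
  finite : T.Finite
  subset : T ⊆ Ioo 0 Real.pi
  perm_iff : ∀ θ ∈ Ioo 0 Real.pi \ T, ∀ ρ, IsSpectralPermutation hA e θ ρ ↔ ρ = τ θ
  constant : ∀ J : Set ℝ, J.OrdConnected → J ⊆ Ioo 0 Real.pi \ T →
    ∀ θ ∈ J, ∀ φ ∈ J, τ θ = τ φ

end RankOnePerturbation

end

/-! Let `lam` be the eigenvalues of `A` and `w` the squared moduli of the coordinates of `e` in an
orthonormal eigenbasis. Cyclicity makes the `lam j` distinct and the `w j` positive. Solving `(z -
A) f = γ ⟨f, e⟩ e` shows that, for `γ ≠ 0`, `z` is an eigenvalue of `A_γ` exactly when `γ = F(z)`,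
with `1 / F(z) = ∑ w j / (z - lam j)`. So `S_θ` is the preimage of an open ray under the rational
function `F = p / q` (`coupling`), of degree `N`. The zeros of `F` are the `lam j`; its poles are
`∞` and the zeros of `q`, which are the eigenvalues of the truncation.

`F` is proper where `q ≠ 0`, hence a finite covering over its noncritical values
(`isCoveringMapOn_coupling`). There are finitely many critical values, and `T` consists of the
arguments of those in the upper half-plane. A closed sector of rays avoiding them is parametrized by
the simply connected plane, so `F` has `N` disjoint inverse branches over it (`exists_sections`).
Restricted to a ray they are the required curves, and using one family of branches for the whole
sector makes the permutation constant there.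

Each branch has a limit at either end, because `|q| / (|p| + |q|)` converges along it to a value
with finite fiber. Two branches cannot share a limit: subtracting `1 / F(z₁) = 1 / F(z₂)` gives `∑ w
j / ((z₁ - lam j) (z₂ - lam j)) = 0`, which, suitably rescaled, would make a positive number vanish
in the limit. By counting, starts and ends are bijections.

Uniqueness of the permutation is a connectedness argument on arcs in the Riemann sphere
(`end_eq_of_iUnion_eq`). For the example, `F(z) = z - 1/z`; on the curve issuing from `1` the sign
of `|z| - 1` is that of `cos θ`, so it ends at `∞` for `θ < π/2` and at `0` for `θ > π/2`. -/

noncomputable section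

namespace RankOnePerturbation

/-! ### The rational function `F = p / q`: zeros, poles, degree and critical points -/

section PoleData

variable {ι : Type*} [Fintype ι] [DecidableEq ι]

/-- The monic polynomial with simple roots at the poles `lam j`. -/
def nodalPoly (lam : ι → ℝ) : Polynomial ℂ :=
  ∏ j, (Polynomial.X - Polynomial.C (lam j : ℂ))

/-- The numerator of `∑ j, w j / (z - lam j)` over the common denominator `nodalPoly lam`. -/
def weightPoly (lam w : ι → ℝ) : Polynomial ℂ :=
  ∑ j, Polynomial.C (w j : ℂ) * ∏ i ∈ Finset.univ.erase j, (Polynomial.X - Polynomial.C (lam i : ℂ))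

/-- The rational function `∑ j, w j / (z - lam j)`. -/
def poleSum (lam w : ι → ℝ) (z : ℂ) : ℂ := ∑ j, (w j : ℂ) / (z - lam j)

/-- The coupling constant `γ` for which `z` is an eigenvalue. -/
def coupling (lam w : ι → ℝ) (z : ℂ) : ℂ :=
  (nodalPoly lam).eval z / (weightPoly lam w).eval z

variable {lam w : ι → ℝ}

omit [DecidableEq ι] in
theorem eval_nodalPoly (z : ℂ) : (nodalPoly lam).eval z = ∏ j, (z - lam j) := by
  simp [nodalPoly, Polynomial.eval_prod]

theorem eval_weightPoly (z : ℂ) :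
    (weightPoly lam w).eval z = ∑ j, (w j : ℂ) * ∏ i ∈ Finset.univ.erase j, (z - lam i) := by
  simp [weightPoly, Polynomial.eval_prod, Polynomial.eval_finsetSum]

omit [DecidableEq ι] in
theorem eval_nodalPoly_eq_zero_iff {z : ℂ} : (nodalPoly lam).eval z = 0 ↔ ∃ j, z = lam j := by
  simp [eval_nodalPoly, Finset.prod_eq_zero_iff, sub_eq_zero]

theorem eval_weightPoly_eq_mul {z : ℂ} (hz : ∀ j, z ≠ lam j) :
    (weightPoly lam w).eval z = (nodalPoly lam).eval z * poleSum lam w z := by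
  rw [eval_weightPoly, eval_nodalPoly, poleSum, Finset.mul_sum]
  refine Finset.sum_congr rfl fun j _ => ?_
  rw [← Finset.mul_prod_erase Finset.univ _ (Finset.mem_univ j)]
  have := sub_ne_zero.2 (hz j)
  field_simp

theorem eval_weightPoly_pole (j : ι) :
    (weightPoly lam w).eval (lam j : ℂ) =
      w j * ∏ i ∈ Finset.univ.erase j, ((lam j : ℂ) - lam i) := by
  rw [eval_weightPoly]
  refine Finset.sum_eq_single j (fun i _ hij => ?_) (by simp)
  rw [Finset.prod_eq_zero (i := j) (by simp [hij.symm]) (by simp), mul_zero]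

theorem eval_weightPoly_pole_ne_zero (hl : Function.Injective lam) (hw : ∀ j, 0 < w j) (j : ι) :
    (weightPoly lam w).eval (lam j : ℂ) ≠ 0 := by
  rw [eval_weightPoly_pole]
  refine mul_ne_zero (by exact_mod_cast (hw j).ne') (Finset.prod_ne_zero_iff.2 fun i hi => ?_)
  rw [sub_ne_zero]
  exact_mod_cast hl.ne (Finset.ne_of_mem_erase hi).symm

theorem eval_nodalPoly_ne_zero_of_eval_weightPoly_eq_zero (hl : Function.Injective lam)
    (hw : ∀ j, 0 < w j) {z : ℂ} (hz : (weightPoly lam w).eval z = 0) :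
    (nodalPoly lam).eval z ≠ 0 := by
  rintro h
  obtain ⟨j, rfl⟩ := eval_nodalPoly_eq_zero_iff.1 h
  exact eval_weightPoly_pole_ne_zero hl hw j hz

theorem coupling_eq_inv_poleSum {z : ℂ} (hz : ∀ j, z ≠ lam j) :
    coupling lam w z = (poleSum lam w z)⁻¹ := by
  have hp : (nodalPoly lam).eval z ≠ 0 := fun h => by
    obtain ⟨j, hj⟩ := eval_nodalPoly_eq_zero_iff.1 h
    exact hz j hj
  rw [coupling, eval_weightPoly_eq_mul hz, div_mul_eq_div_div, div_self hp, one_div]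

/-- The condition `γ ≠ 0` excludes the zeros of `weightPoly`, where division by zero gives
`coupling` the value `0`. -/
theorem coupling_eq_iff (hl : Function.Injective lam) (hw : ∀ j, 0 < w j) {z γ : ℂ}
    (hγ : γ ≠ 0) : coupling lam w z = γ ↔
      (nodalPoly lam).eval z = γ * (weightPoly lam w).eval z := by
  constructor
  · rintro rfl
    have : (weightPoly lam w).eval z ≠ 0 := fun h => hγ (by simp [coupling, h])
    rw [coupling, div_mul_cancel₀ _ this]
  · intro h
    have : (weightPoly lam w).eval z ≠ 0 := fun h0 =>
      eval_nodalPoly_ne_zero_of_eval_weightPoly_eq_zero hl hw h0 (by simp [h, h0])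
    rw [coupling, h, mul_div_cancel_right₀ _ this]

theorem ne_pole_of_coupling_ne_zero {z : ℂ} (hz : coupling lam w z ≠ 0) (j : ι) :
    z ≠ lam j := by
  rintro rfl
  exact hz (by rw [coupling, eval_nodalPoly_eq_zero_iff.2 ⟨j, rfl⟩, zero_div])

omit [DecidableEq ι] in
theorem im_poleSum (z : ℂ) :
    (poleSum lam w z).im = -(z.im * ∑ j, w j / Complex.normSq (z - lam j)) := by
  rw [poleSum, Complex.im_sum, Finset.mul_sum, ← Finset.sum_neg_distrib]
  refine Finset.sum_congr rfl fun j _ => ?_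
  rw [Complex.div_im]
  simp
  ring

omit [DecidableEq ι] in
theorem sum_div_normSq_pos [Nonempty ι] (hw : ∀ j, 0 < w j) {z : ℂ} (hz : ∀ j, z ≠ lam j) :
    0 < ∑ j, w j / Complex.normSq (z - lam j) :=
  Finset.sum_pos (fun j _ => div_pos (hw j) (Complex.normSq_pos.2 (sub_ne_zero.2 (hz j))))
    Finset.univ_nonempty

/-- Every term of `poleSum` has imaginary part of sign opposite to that of `z.im`, and inversion
flips the sign back. This puts the curves in the upper half-plane. -/
theorem im_pos_of_im_coupling_pos [Nonempty ι] (hw : ∀ j, 0 < w j) {z : ℂ}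
    (hz : 0 < (coupling lam w z).im) : 0 < z.im := by
  have hne : coupling lam w z ≠ 0 := fun h => by simp [h] at hz
  have hp := ne_pole_of_coupling_ne_zero hne
  have hs := sum_div_normSq_pos hw hp
  rw [coupling_eq_inv_poleSum hp, Complex.inv_im, im_poleSum, neg_neg] at hz
  by_contra h
  exact absurd hz (not_lt.2 (div_nonpos_of_nonpos_of_nonneg
    (mul_nonpos_of_nonpos_of_nonneg (not_lt.1 h) hs.le) (Complex.normSq_nonneg _)))

theorem im_eq_zero_of_eval_weightPoly_eq_zero [Nonempty ι] (hl : Function.Injective lam)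
    (hw : ∀ j, 0 < w j) {z : ℂ} (hz : (weightPoly lam w).eval z = 0) : z.im = 0 := by
  have hp : ∀ j, z ≠ lam j := by
    rintro j rfl
    exact eval_weightPoly_pole_ne_zero hl hw j hz
  have h0 := eval_nodalPoly_ne_zero_of_eval_weightPoly_eq_zero hl hw hz
  rw [eval_weightPoly_eq_mul hp, mul_eq_zero, or_iff_right h0] at hz
  have := im_poleSum (lam := lam) (w := w) z
  rw [hz, Complex.zero_im, eq_comm, neg_eq_zero, mul_eq_zero] at this
  exact this.resolve_right (sum_div_normSq_pos hw hp).ne'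

omit [DecidableEq ι] in
theorem tendsto_poleSum_cobounded : Tendsto (poleSum lam w) (Bornology.cobounded ℂ) (𝓝 0) := by
  have : Tendsto (fun z : ℂ => ∑ j, (w j : ℂ) * (z - lam j)⁻¹) (Bornology.cobounded ℂ)
      (𝓝 (∑ j, (w j : ℂ) * 0)) := by
    refine tendsto_finsetSum _ fun j _ => Tendsto.const_mul _ ?_
    exact tendsto_inv₀_cobounded.comp (tendsto_sub_const_cobounded (lam j : ℂ))
  simp only [mul_zero, Finset.sum_const_zero] at this
  exact this.congr fun z => by simp [poleSum, div_eq_mul_inv]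

omit [DecidableEq ι] in
theorem eventually_cobounded_ne_pole : ∀ᶠ z : ℂ in Bornology.cobounded ℂ, ∀ j, z ≠ lam j := by
  rw [eventually_all]
  exact fun j => Bornology.eventually_ne_cobounded (lam j : ℂ)

omit [DecidableEq ι] in
theorem monic_nodalPoly : (nodalPoly lam).Monic :=
  Polynomial.monic_prod_of_monic _ _ fun _ _ => Polynomial.monic_X_sub_C _

omit [DecidableEq ι] in
theorem natDegree_nodalPoly : (nodalPoly lam).natDegree = Fintype.card ι := by
  rw [nodalPoly, Polynomial.natDegree_prod_of_monic _ _ fun _ _ => Polynomial.monic_X_sub_C _]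
  simp

theorem degree_C_mul_le_degree (a : ℂ) (P : Polynomial ℂ) :
    (Polynomial.C a * P).degree ≤ P.degree := by
  rw [← Polynomial.smul_eq_C_mul]
  exact Polynomial.degree_smul_le a P

theorem degree_weightPoly_lt : (weightPoly lam w).degree < (nodalPoly lam).degree := by
  rw [Polynomial.degree_eq_natDegree monic_nodalPoly.ne_zero, natDegree_nodalPoly]
  refine lt_of_le_of_lt (Polynomial.degree_sum_le _ _) ?_
  rw [Finset.sup_lt_iff (WithBot.bot_lt_coe _)]
  intro j _
  refine lt_of_le_of_lt (degree_C_mul_le_degree _ _) ?_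
  rw [Polynomial.degree_prod]
  simp only [Polynomial.degree_X_sub_C, Finset.sum_const, nsmul_eq_mul, mul_one]
  exact_mod_cast Finset.card_lt_univ_of_notMem (Finset.notMem_erase j _)

/-- Since `deg q < deg p`, the polynomial `p - γ q` keeps degree `N` for every `γ`, so no root of it
escapes to infinity at a finite coupling. -/
theorem monic_sub_weightPoly (γ : ℂ) :
    (nodalPoly lam - Polynomial.C γ * weightPoly lam w).Monic :=
  monic_nodalPoly.sub_of_left
    (lt_of_le_of_lt (degree_C_mul_le_degree _ _) degree_weightPoly_lt)

theorem natDegree_sub_weightPoly (γ : ℂ) :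
    (nodalPoly lam - Polynomial.C γ * weightPoly lam w).natDegree = Fintype.card ι := by
  rw [← natDegree_nodalPoly (lam := lam)]
  refine Polynomial.natDegree_eq_of_degree_eq (Polynomial.degree_sub_eq_left_of_degree_lt
    (lt_of_le_of_lt (degree_C_mul_le_degree _ _) degree_weightPoly_lt))

theorem finite_coupling_fiber (hl : Function.Injective lam) (hw : ∀ j, 0 < w j) {γ : ℂ}
    (hγ : γ ≠ 0) : {z | coupling lam w z = γ}.Finite := by
  refine (Polynomial.finite_setOfPred_isRoot
    (monic_sub_weightPoly (lam := lam) (w := w) γ).ne_zero).subset fun z hz => ?_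
  rw [mem_ofPred_eq, coupling_eq_iff hl hw hγ] at hz
  simp [hz]

/-- The numerator of the derivative of `coupling lam w`. -/
def couplingWronskian (lam w : ι → ℝ) : Polynomial ℂ :=
  (nodalPoly lam).derivative * weightPoly lam w - nodalPoly lam * (weightPoly lam w).derivative

theorem hasStrictDerivAt_coupling {z : ℂ} (hz : (weightPoly lam w).eval z ≠ 0) :
    HasStrictDerivAt (coupling lam w)
      ((couplingWronskian lam w).eval z / (weightPoly lam w).eval z ^ 2) z := by
  have := ((nodalPoly lam).hasStrictDerivAt z).div ((weightPoly lam w).hasStrictDerivAt z) hz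
  simp only [couplingWronskian, Polynomial.eval_sub, Polynomial.eval_mul]
  exact this

/-- At `lam j` the Wronskian `p' q - p q'` reduces to `p' q`, and both factors are nonzero there
because the roots of `p` are simple. -/
theorem couplingWronskian_ne_zero [Nonempty ι] (hl : Function.Injective lam)
    (hw : ∀ j, 0 < w j) : couplingWronskian lam w ≠ 0 := by
  intro h
  obtain ⟨j⟩ := ‹Nonempty ι›
  have h1 := congrArg (Polynomial.eval (lam j : ℂ)) h
  have h0 : (nodalPoly lam).eval (lam j : ℂ) = 0 := eval_nodalPoly_eq_zero_iff.2 ⟨j, rfl⟩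
  have hs : (nodalPoly lam).Separable := by
    rw [nodalPoly, Polynomial.separable_prod_X_sub_C_iff]
    exact Complex.ofReal_injective.comp hl
  have hd := hs.aeval_derivative_ne_zero (x := (lam j : ℂ)) (by simpa using h0)
  simp [couplingWronskian, h0, eval_weightPoly_pole_ne_zero hl hw j] at h1
  exact hd (by simpa using h1)

/-- A multiple root of `p - γ q` would satisfy `p = γ q` and `p' = γ q'`, making the Wronskian
vanish. So the `N` roots are distinct. -/
theorem card_coupling_fiber (hl : Function.Injective lam) (hw : ∀ j, 0 < w j) {γ : ℂ}
    (hγ : γ ≠ 0) (hreg : ∀ z, coupling lam w z = γ → (couplingWronskian lam w).eval z ≠ 0) :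
    {z | coupling lam w z = γ}.ncard = Fintype.card ι := by
  set P := nodalPoly lam - Polynomial.C γ * weightPoly lam w with hP
  have hP0 : P ≠ 0 := (monic_sub_weightPoly γ).ne_zero
  have hroot : ∀ z, z ∈ P.roots ↔ coupling lam w z = γ := fun z => by
    rw [Polynomial.mem_roots hP0, coupling_eq_iff hl hw hγ]
    simp [hP, sub_eq_zero]
  have hnd : P.roots.Nodup := by
    refine Multiset.nodup_iff_count_le_one.2 fun z => ?_
    rw [Polynomial.count_roots]
    by_contra! hc
    obtain ⟨h1, h2⟩ := (Polynomial.one_lt_rootMultiplicity_iff_isRoot hP0).1 hc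
    refine hreg z ((hroot z).1 ((Polynomial.mem_roots hP0).2 h1)) ?_
    simp only [hP, Polynomial.IsRoot, Polynomial.derivative_sub, Polynomial.derivative_mul,
      Polynomial.derivative_C, zero_mul, zero_add, Polynomial.eval_sub, Polynomial.eval_mul,
      Polynomial.eval_C] at h1 h2
    simp only [couplingWronskian, Polynomial.eval_sub, Polynomial.eval_mul]
    linear_combination (weightPoly lam w).eval z * h2
      - (weightPoly lam w).derivative.eval z * h1
  have hset : {z | coupling lam w z = γ} = (P.roots.toFinset : Set ℂ) := by
    ext z
    simp only [mem_ofPred_eq, Finset.mem_coe, Multiset.mem_toFinset, hroot]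
  rw [hset, Set.ncard_coe_finset, Multiset.toFinset_card_of_nodup hnd,
    ← (IsAlgClosed.splits P).natDegree_eq_card_roots, natDegree_sub_weightPoly]

/-- The ratio `|q| / (|p| + |q|)`, a continuous function on the Riemann sphere. -/
def poleGauge (lam w : ι → ℝ) (x : OnePoint ℂ) : ℝ :=
  x.elim 0 fun z => ‖(weightPoly lam w).eval z‖ /
    (‖(nodalPoly lam).eval z‖ + ‖(weightPoly lam w).eval z‖)

theorem norm_add_norm_pos (hl : Function.Injective lam) (hw : ∀ j, 0 < w j) (z : ℂ) :
    0 < ‖(nodalPoly lam).eval z‖ + ‖(weightPoly lam w).eval z‖ := by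
  by_cases h : (weightPoly lam w).eval z = 0
  · have := norm_pos_iff.2 (eval_nodalPoly_ne_zero_of_eval_weightPoly_eq_zero hl hw h)
    positivity
  · have := norm_pos_iff.2 h
    positivity

/-- Continuity at `∞`, where the value is `0`, holds because the ratio is bounded by `|q / p| =
|poleSum|` off the poles. The denominator never vanishes, as `p` and `q` have no common zero. -/
theorem continuous_poleGauge (hl : Function.Injective lam) (hw : ∀ j, 0 < w j) :
    Continuous (poleGauge lam w) := by
  rw [OnePoint.continuous_iff]
  constructor
  · rw [coclosedCompact_eq_cocompact, ← Metric.cobounded_eq_cocompact]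
    have h1 : Tendsto (fun z => ‖poleSum lam w z‖) (Bornology.cobounded ℂ) (𝓝 0) := by
      simpa using (tendsto_poleSum_cobounded (lam := lam) (w := w)).norm
    refine squeeze_zero' (Eventually.of_forall fun z => ?_) ?_ h1
    · simp only [poleGauge, OnePoint.elim_some]
      positivity
    · filter_upwards [eventually_cobounded_ne_pole (lam := lam)] with z hz
      have hp : (nodalPoly lam).eval z ≠ 0 := fun h => by
        obtain ⟨j, hj⟩ := eval_nodalPoly_eq_zero_iff.1 h
        exact hz j hj
      simp only [poleGauge, OnePoint.elim_some]
      rw [div_le_iff₀ (norm_add_norm_pos hl hw z)]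
      have h2 : ‖(weightPoly lam w).eval z‖ = ‖poleSum lam w z‖ * ‖(nodalPoly lam).eval z‖ := by
        rw [eval_weightPoly_eq_mul hz, norm_mul, mul_comm]
      have := mul_nonneg (norm_nonneg (poleSum lam w z)) (norm_nonneg ((weightPoly lam w).eval z))
      nlinarith
  · change Continuous fun z : ℂ => ‖(weightPoly lam w).eval z‖ /
      (‖(nodalPoly lam).eval z‖ + ‖(weightPoly lam w).eval z‖)
    exact (Polynomial.continuous _).norm.div
      ((Polynomial.continuous _).norm.add (Polynomial.continuous _).norm)
      fun z => (norm_add_norm_pos hl hw z).ne'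

theorem poleGauge_coe_eq_zero_iff (hl : Function.Injective lam) (hw : ∀ j, 0 < w j) {z : ℂ} :
    poleGauge lam w z = 0 ↔ (weightPoly lam w).eval z = 0 := by
  change _ / _ = (0 : ℝ) ↔ _
  rw [div_eq_zero_iff, or_iff_left (norm_add_norm_pos hl hw z).ne', norm_eq_zero]

theorem poleGauge_eq_one_iff (hl : Function.Injective lam) (hw : ∀ j, 0 < w j) {x : OnePoint ℂ} :
    poleGauge lam w x = 1 ↔ ∃ j, x = ((lam j : ℂ) : OnePoint ℂ) := by
  induction x using OnePoint.rec with
  | infty => simp [poleGauge]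
  | coe z =>
    change _ / _ = (1 : ℝ) ↔ _
    rw [div_eq_one_iff_eq (norm_add_norm_pos hl hw z).ne', right_eq_add, norm_eq_zero,
      eval_nodalPoly_eq_zero_iff]
    simp

/-- The gauge depends only on `|F|`, so it is known along any lift of a prescribed path of
couplings. -/
theorem poleGauge_coe {z : ℂ} (hz : (weightPoly lam w).eval z ≠ 0) :
    poleGauge lam w z = (‖coupling lam w z‖ + 1)⁻¹ := by
  change _ / _ = _
  have := norm_ne_zero_iff.2 hz
  rw [coupling, norm_div]
  field_simp

/-- The difference of the two values of `poleSum` has the factor `z₁ - z₂`; dividing it out leaves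
an identity that survives when both points run to the same limit. -/
theorem sum_div_mul_eq_zero_of_coupling_eq {z₁ z₂ : ℂ} (h : coupling lam w z₁ = coupling lam w z₂)
    (h0 : coupling lam w z₁ ≠ 0) (hne : z₁ ≠ z₂) :
    ∑ j, (w j : ℂ) / ((z₁ - lam j) * (z₂ - lam j)) = 0 := by
  have h1 := ne_pole_of_coupling_ne_zero h0
  have h2 := ne_pole_of_coupling_ne_zero (h ▸ h0)
  rw [coupling_eq_inv_poleSum h1, coupling_eq_inv_poleSum h2, inv_inj] at h
  have key : poleSum lam w z₂ - poleSum lam w z₁ =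
      (z₁ - z₂) * ∑ j, (w j : ℂ) / ((z₁ - lam j) * (z₂ - lam j)) := by
    rw [poleSum, poleSum, ← Finset.sum_sub_distrib, Finset.mul_sum]
    refine Finset.sum_congr rfl fun j _ => ?_
    have := sub_ne_zero.2 (h1 j)
    have := sub_ne_zero.2 (h2 j)
    field_simp
    ring
  rw [h, sub_self, eq_comm, mul_eq_zero, sub_eq_zero] at key
  exact key.resolve_left hne

end PoleData

/-! ### Limits along half-planes -/

/-- A continuous map into a compact Hausdorff space converges along a filter with small preconnected
sets if its composition with a real function `g` converges to a value with finite fiber. -/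
theorem exists_tendsto_of_tendsto_comp {X Y : Type*} [TopologicalSpace X] [CompactSpace X]
    [T2Space X] [TopologicalSpace Y] {L : Filter Y} [NeBot L]
    (hL : ∀ U ∈ L, ∃ V ∈ L, V ⊆ U ∧ IsPreconnected V) {f : Y → X} (hf : Continuous f)
    {g : X → ℝ} (hg : Continuous g) {c : ℝ} (hfin : (g ⁻¹' {c}).Finite)
    (hlim : Tendsto (g ∘ f) L (𝓝 c)) : ∃ x, g x = c ∧ Tendsto f L (𝓝 x) := by
  obtain ⟨U, hU, hdisj⟩ := hfin.t2_separation
  -- Since `g` is a closed map, every open neighbourhood of the fiber over `c` contains the preimage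
  -- of a neighbourhood of `c`.
  have key : ∀ O : Set X, IsOpen O → g ⁻¹' {c} ⊆ O → ∀ᶠ y in L, f y ∈ O := fun O hO hKO =>
    (tendsto_comap_iff.2 hlim).eventually
      (isClosedMap_iff_comap_nhds_le.1 hg.isClosedMap (hO.mem_nhdsSet.2 hKO))
  have hO : ∀ x₀, IsOpen (⋃ x ∈ (g ⁻¹' {c}) \ {x₀}, U x) := fun x₀ =>
    isOpen_biUnion fun x _ => (hU x).2
  obtain ⟨V, hVL, hVU, hV⟩ := hL _ (key (⋃ x ∈ g ⁻¹' {c}, U x)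
    (isOpen_biUnion fun x _ => (hU x).2) fun x hx => mem_biUnion hx (hU x).1)
  obtain ⟨y₀, hy₀⟩ := Filter.nonempty_of_mem hVL
  obtain ⟨x₀, hx₀, hyx⟩ := mem_iUnion₂.1 (hVU hy₀)
  have hd : Disjoint (U x₀) (⋃ x ∈ (g ⁻¹' {c}) \ {x₀}, U x) :=
    disjoint_iUnion₂_right.2 fun x hx => hdisj hx₀ hx.1 (Ne.symm hx.2)
  -- A connected set covered by the disjoint neighbourhoods of the fiber points stays in one of
  -- them, which singles out the limit `x₀`.
  have hsub : f '' V ⊆ U x₀ := by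
    refine (hV.image f hf.continuousOn).subset_left_of_subset_union (hU x₀).2 (hO x₀) hd ?_
      ⟨f y₀, mem_image_of_mem f hy₀, hyx⟩
    rintro _ ⟨y, hy, rfl⟩
    obtain ⟨x, hx, hyx⟩ := mem_iUnion₂.1 (hVU hy)
    by_cases h : x = x₀
    · exact Or.inl (h ▸ hyx)
    · exact Or.inr (mem_biUnion ⟨hx, h⟩ hyx)
  refine ⟨x₀, hx₀, ?_⟩
  rw [(nhds_basis_opens x₀).tendsto_right_iff]
  rintro O ⟨hxO, hOo⟩
  filter_upwards [hVL, key (O ∪ ⋃ x ∈ (g ⁻¹' {c}) \ {x₀}, U x) (hOo.union (hO x₀)) (fun x hx => by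
    by_cases h : x = x₀
    · exact Or.inl (h ▸ hxO)
    · exact Or.inr (mem_biUnion ⟨hx, h⟩ (hU x).1))] with y hy h
  exact h.resolve_right fun h' => disjoint_left.1 hd (hsub (mem_image_of_mem f hy)) h'

/-- Left half-planes. -/
abbrev reAtBot : Filter ℂ := comap Complex.re atBot

/-- Right half-planes. -/
abbrev reAtTop : Filter ℂ := comap Complex.re atTop

instance : NeBot reAtBot := comap_neBot_iff_frequently.2
  (Eventually.frequently (Eventually.of_forall fun x : ℝ => ⟨x, Complex.ofReal_re x⟩))

instance : NeBot reAtTop := comap_neBot_iff_frequently.2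
  (Eventually.frequently (Eventually.of_forall fun x : ℝ => ⟨x, Complex.ofReal_re x⟩))

theorem exists_preconnected_mem_reAtBot : ∀ U ∈ reAtBot, ∃ V ∈ reAtBot, V ⊆ U ∧ IsPreconnected V := by
  intro U hU
  obtain ⟨a, -, ha⟩ := (atBot_basis.comap Complex.re).mem_iff.1 hU
  exact ⟨_, (atBot_basis.comap Complex.re).mem_of_mem trivial, ha,
    (convex_halfSpace_re_le a).isPreconnected⟩

theorem exists_preconnected_mem_reAtTop : ∀ U ∈ reAtTop, ∃ V ∈ reAtTop, V ⊆ U ∧ IsPreconnected V := by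
  intro U hU
  obtain ⟨a, -, ha⟩ := (atTop_basis.comap Complex.re).mem_iff.1 hU
  exact ⟨_, (atTop_basis.comap Complex.re).mem_of_mem trivial, ha,
    (convex_halfSpace_re_ge a).isPreconnected⟩

/-! ### The coupling function as a covering map -/

section Covering

variable {ι : Type*} [Fintype ι] [DecidableEq ι] {lam w : ι → ℝ}

/-- The map is proper. Points with `|F| ≤ M` lie in the closed set `|p| ≤ M |q|`, which is bounded
because `q / p → 0` at infinity and misses the zeros of `q` because `p ≠ 0` there. -/
theorem isClosedMap_coupling (hl : Function.Injective lam) (hw : ∀ j, 0 < w j) :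
    IsClosedMap fun z : {z : ℂ // (weightPoly lam w).eval z ≠ 0} => coupling lam w z := by
  refine IsProperMap.isClosedMap (isProperMap_iff_isCompact_preimage.2 ⟨?_, fun K hK => ?_⟩)
  · exact ((Polynomial.continuous _).comp continuous_subtype_val).div
      ((Polynomial.continuous _).comp continuous_subtype_val) fun z => z.2
  obtain ⟨M, hM⟩ := hK.isBounded.exists_norm_le
  set S : Set ℂ := {z | ‖(nodalPoly lam).eval z‖ ≤ M * ‖(weightPoly lam w).eval z‖} with hS
  have hS0 : ∀ z ∈ S, (weightPoly lam w).eval z ≠ 0 := fun z hz h => by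
    simp only [hS, mem_ofPred_eq, h, norm_zero, mul_zero] at hz
    exact eval_nodalPoly_ne_zero_of_eval_weightPoly_eq_zero hl hw h
      (norm_le_zero_iff.1 hz)
  have hSc : IsClosed S := isClosed_le (Polynomial.continuous _).norm
    (continuous_const.mul (Polynomial.continuous _).norm)
  have hSb : Bornology.IsBounded S := by
    rw [Bornology.isBounded_def]
    have hR : ∀ᶠ z in Bornology.cobounded ℂ, ‖poleSum lam w z‖ < (|M| + 1)⁻¹ := by
      refine (tendsto_poleSum_cobounded (lam := lam) (w := w)).norm.eventually_lt_const ?_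
      rw [norm_zero]
      positivity
    filter_upwards [hR, eventually_cobounded_ne_pole (lam := lam)] with z hz hzp hzS
    have hp : 0 < ‖(nodalPoly lam).eval z‖ := norm_pos_iff.2 fun h => by
      obtain ⟨j, hj⟩ := eval_nodalPoly_eq_zero_iff.1 h
      exact hzp j hj
    simp only [hS, mem_ofPred_eq, eval_weightPoly_eq_mul hzp, norm_mul] at hzS
    have h1 : |M| * ‖poleSum lam w z‖ < 1 := by
      rw [← one_div, lt_div_iff₀ (by positivity)] at hz
      nlinarith [norm_nonneg (poleSum lam w z)]
    have h2 : M * ‖poleSum lam w z‖ < 1 :=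
      (mul_le_mul_of_nonneg_right (le_abs_self M) (norm_nonneg _)).trans_lt h1
    nlinarith
  have hcl : IsClosed (S ∩ coupling lam w ⁻¹' K) := by
    refine ContinuousOn.preimage_isClosed_of_isClosed (fun z hz => ?_) hSc hK.isClosed
    exact (hasStrictDerivAt_coupling (hS0 z hz)).hasDerivAt.continuousAt.continuousWithinAt
  refine (Topology.IsInducing.subtypeVal
    (t := {z : ℂ | (weightPoly lam w).eval z ≠ 0})).isCompact_iff.2 ?_
  convert Metric.isCompact_of_isClosed_isBounded hcl (hSb.subset inter_subset_left) using 1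
  ext z
  constructor
  · rintro ⟨⟨z, hz⟩, hzK, rfl⟩
    refine ⟨?_, hzK⟩
    have : ‖coupling lam w z‖ ≤ M := hM _ hzK
    rwa [coupling, norm_div, div_le_iff₀ (norm_pos_iff.2 hz)] at this
  · rintro ⟨hzS, hzK⟩
    exact ⟨⟨z, hS0 z hzS⟩, hzK, rfl⟩

/-- The points of the upper half-plane that are not critical values of the coupling function. -/
def regularCouplings (lam w : ι → ℝ) : Set ℂ :=
  {γ | 0 < γ.im ∧ ∀ z, coupling lam w z = γ → (couplingWronskian lam w).eval z ≠ 0}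

theorem eval_weightPoly_ne_zero_of_coupling_ne_zero {z : ℂ} (hz : coupling lam w z ≠ 0) :
    (weightPoly lam w).eval z ≠ 0 := fun h => hz (by simp [coupling, h])

theorem ne_zero_of_mem_regularCouplings {γ : ℂ} (hγ : γ ∈ regularCouplings lam w) : γ ≠ 0 := by
  rintro rfl
  simpa using hγ.1

theorem isLocalHomeomorphOn_coupling :
    IsLocalHomeomorphOn (coupling lam w) (coupling lam w ⁻¹' regularCouplings lam w) := by
  intro z hz
  have hq := eval_weightPoly_ne_zero_of_coupling_ne_zero (ne_zero_of_mem_regularCouplings hz)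
  have hd := (hasStrictDerivAt_coupling hq).hasStrictFDerivAt_equiv
    (div_ne_zero (hz.2 z rfl) (pow_ne_zero 2 hq))
  exact ⟨hd.toOpenPartialHomeomorph _, hd.mem_toOpenPartialHomeomorph_source,
    (hd.toOpenPartialHomeomorph_coe).symm⟩

/-- A closed map with finite fibers that is a local homeomorphism over the base is a covering. The
zeros of `q` are removed from the source, since the value assigned to `F` there is artificial. -/
theorem isCoveringMapOn_coupling (hl : Function.Injective lam) (hw : ∀ j, 0 < w j) :
    IsCoveringMapOn (fun z : {z : ℂ // (weightPoly lam w).eval z ≠ 0} => coupling lam w z)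
      (regularCouplings lam w) := by
  refine (isClosedMap_coupling hl hw).isCoveringMapOn_of_isLocalHomeomorphOn (fun γ hγ => ?_) ?_
  · exact (Set.Finite.preimage Subtype.val_injective.injOn
      (finite_coupling_fiber hl hw (ne_zero_of_mem_regularCouplings hγ)) :)
  · have ho : IsLocalHomeomorph (Subtype.val : {z : ℂ // (weightPoly lam w).eval z ≠ 0} → ℂ) :=
      (IsOpen.isOpenEmbedding_subtypeVal
        (s := {z : ℂ | (weightPoly lam w).eval z ≠ 0}) (isOpen_ne_fun (Polynomial.continuous _) continuous_const)).isLocalHomeomorph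
    exact isLocalHomeomorphOn_coupling.comp
      (fun z _ => ho z) fun z hz => hz

end Covering

/-! ### Inverse branches and their limits -/

section Sections

variable {ι : Type*} [Fintype ι] [DecidableEq ι] {lam w : ι → ℝ}

/-- Multiply the vanishing sum by `(f₁ - lam r) (f₂ - lam r)`: the term `r` is constantly `w r` and
the others tend to `0`, so `w r = 0`. -/
theorem not_tendsto_same_pole {Y : Type*} {L : Filter Y} [NeBot L]
    (hl : Function.Injective lam) (hw : ∀ j, 0 < w j) {f₁ f₂ : Y → ℂ}
    (h : ∀ y, coupling lam w (f₁ y) = coupling lam w (f₂ y))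
    (h0 : ∀ y, coupling lam w (f₁ y) ≠ 0) (hne : ∀ y, f₁ y ≠ f₂ y) {r : ι}
    (h₁ : Tendsto f₁ L (𝓝 (lam r : ℂ))) (h₂ : Tendsto f₂ L (𝓝 (lam r : ℂ))) : False := by
  have hterm : ∀ j, Tendsto (fun y => (w j : ℂ) * ((f₁ y - lam r) / (f₁ y - lam j)) *
      ((f₂ y - lam r) / (f₂ y - lam j))) L (𝓝 (if j = r then (w r : ℂ) else 0)) := by
    intro j
    by_cases hj : j = r
    · subst hj
      refine tendsto_const_nhds.congr fun y => ?_
      have := sub_ne_zero.2 (ne_pole_of_coupling_ne_zero (h0 y) j)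
      have := sub_ne_zero.2 (ne_pole_of_coupling_ne_zero (h y ▸ h0 y) j)
      simp only [if_true]
      field_simp
    · rw [if_neg hj]
      have hrj : (lam r : ℂ) - lam j ≠ 0 := sub_ne_zero.2 (by exact_mod_cast hl.ne (Ne.symm hj))
      have h := ((((h₁.sub_const (lam r : ℂ)).div (h₁.sub_const (lam j : ℂ)) hrj).const_mul
        (w j : ℂ))).mul ((h₂.sub_const (lam r : ℂ)).div (h₂.sub_const (lam j : ℂ)) hrj)
      simpa using h
  have hsum := tendsto_finsetSum Finset.univ fun j _ => hterm j
  rw [Finset.sum_ite_eq' Finset.univ r, if_pos (Finset.mem_univ r)] at hsum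
  have hzero : ∀ y, ∑ j, (w j : ℂ) * ((f₁ y - lam r) / (f₁ y - lam j)) *
      ((f₂ y - lam r) / (f₂ y - lam j)) = 0 := fun y => by
    have := sum_div_mul_eq_zero_of_coupling_eq (h y) (h0 y) (hne y)
    rw [← mul_zero ((f₁ y - lam r) * (f₂ y - lam r)), ← this, Finset.mul_sum]
    refine Finset.sum_congr rfl fun j _ => ?_
    rw [mul_assoc, div_mul_div_comm]
    ring
  simp only [hzero] at hsum
  have := tendsto_nhds_unique hsum tendsto_const_nhds
  exact (hw r).ne' (by exact_mod_cast this)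

/-- The vanishing sum tends to `∑ w j / (δ - lam j) ^ 2`, which is positive because `δ` is real. -/
theorem not_tendsto_same_zero [Nonempty ι] {Y : Type*} {L : Filter Y} [NeBot L]
    (hl : Function.Injective lam) (hw : ∀ j, 0 < w j) {f₁ f₂ : Y → ℂ}
    (h : ∀ y, coupling lam w (f₁ y) = coupling lam w (f₂ y))
    (h0 : ∀ y, coupling lam w (f₁ y) ≠ 0) (hne : ∀ y, f₁ y ≠ f₂ y) {δ : ℂ}
    (hδ : (weightPoly lam w).eval δ = 0)
    (h₁ : Tendsto f₁ L (𝓝 δ)) (h₂ : Tendsto f₂ L (𝓝 δ)) : False := by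
  have hδp : ∀ j, δ ≠ lam j := by
    rintro j rfl
    exact eval_weightPoly_pole_ne_zero hl hw j hδ
  have hsum : Tendsto (fun y => ∑ j, (w j : ℂ) / ((f₁ y - lam j) * (f₂ y - lam j))) L
      (𝓝 (∑ j, (w j : ℂ) / ((δ - lam j) * (δ - lam j)))) := by
    refine tendsto_finsetSum _ fun j _ => tendsto_const_nhds.div
      ((h₁.sub_const _).mul (h₂.sub_const _)) ?_
    have := sub_ne_zero.2 (hδp j)
    exact mul_ne_zero this this
  simp only [fun y => sum_div_mul_eq_zero_of_coupling_eq (h y) (h0 y) (hne y)] at hsum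
  have h3 := tendsto_nhds_unique hsum tendsto_const_nhds
  have hre : ((δ.re : ℝ) : ℂ) = δ :=
    Complex.ext rfl (im_eq_zero_of_eval_weightPoly_eq_zero hl hw hδ).symm
  rw [← hre] at h3 hδp
  have h4 : (∑ j, w j / ((δ.re - lam j) * (δ.re - lam j))) = 0 := by exact_mod_cast h3
  refine absurd h4 (Finset.sum_pos (fun j _ => div_pos (hw j) ?_) Finset.univ_nonempty).ne'
  exact mul_self_pos.2 (sub_ne_zero.2 fun h => hδp j (by rw [h]))

theorem tendsto_div_sub_cobounded (a : ℂ) :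
    Tendsto (fun z : ℂ => z / (z - a)) (Bornology.cobounded ℂ) (𝓝 1) := by
  have h : Tendsto (fun z : ℂ => 1 + a * (z - a)⁻¹) (Bornology.cobounded ℂ) (𝓝 (1 + a * 0)) :=
    tendsto_const_nhds.add (Tendsto.const_mul _
      (tendsto_inv₀_cobounded.comp (tendsto_sub_const_cobounded a)))
  rw [mul_zero, add_zero] at h
  refine h.congr' ?_
  filter_upwards [Bornology.eventually_ne_cobounded a] with z hz
  have := sub_ne_zero.2 hz
  field_simp
  ring

/-- After multiplication by `f₁ f₂` the vanishing sum tends to `∑ w j > 0`. -/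
theorem not_tendsto_same_infty [Nonempty ι] {Y : Type*} {L : Filter Y} [NeBot L]
    (hw : ∀ j, 0 < w j) {f₁ f₂ : Y → ℂ}
    (h : ∀ y, coupling lam w (f₁ y) = coupling lam w (f₂ y))
    (h0 : ∀ y, coupling lam w (f₁ y) ≠ 0) (hne : ∀ y, f₁ y ≠ f₂ y)
    (h₁ : Tendsto f₁ L (Bornology.cobounded ℂ)) (h₂ : Tendsto f₂ L (Bornology.cobounded ℂ)) :
    False := by
  have hsum : Tendsto (fun y => ∑ j, (w j : ℂ) * (f₁ y / (f₁ y - lam j)) *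
      (f₂ y / (f₂ y - lam j))) L (𝓝 (∑ j, (w j : ℂ) * 1 * 1)) :=
    tendsto_finsetSum _ fun j _ => (((tendsto_div_sub_cobounded _).comp h₁).const_mul _).mul
      ((tendsto_div_sub_cobounded _).comp h₂)
  have hzero : ∀ y, ∑ j, (w j : ℂ) * (f₁ y / (f₁ y - lam j)) * (f₂ y / (f₂ y - lam j)) = 0 :=
    fun y => by
      rw [← mul_zero (f₁ y * f₂ y),
        ← sum_div_mul_eq_zero_of_coupling_eq (h y) (h0 y) (hne y), Finset.mul_sum]
      refine Finset.sum_congr rfl fun j _ => ?_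
      rw [mul_assoc, div_mul_div_comm]
      ring
  simp only [hzero, mul_one] at hsum
  have := tendsto_nhds_unique hsum tendsto_const_nhds
  exact (Finset.sum_pos (fun j _ => hw j) Finset.univ_nonempty).ne' (by exact_mod_cast this)

/-- The plane is simply connected, so `c` lifts through the covering from each point over `c 0`, and
uniqueness of lifts keeps the lifts disjoint. There are `N` of them, so the injective assignments of
start and end points are bijections; `ρ` is the second composed with the inverse of the first. -/
theorem exists_sections [Nonempty ι] (hl : Function.Injective lam) (hw : ∀ j, 0 < w j)
    {d : ι → OnePoint ℂ} (hd : ∀ x, poleGauge lam w x = 0 ↔ x ∈ range d) (c : C(ℂ, ℂ))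
    (hc : ∀ u, c u ∈ regularCouplings lam w)
    (hbot : Tendsto (fun u => ‖c u‖) reAtBot (𝓝 0))
    (htop : Tendsto (fun u => ‖c u‖) reAtTop atTop) :
    ∃ (ℓ : ι → C(ℂ, ℂ)) (ρ : Equiv.Perm ι),
      (∀ r u, coupling lam w (ℓ r u) = c u) ∧
      (∀ r s u, r ≠ s → ℓ r u ≠ ℓ s u) ∧
      (∀ u z, coupling lam w z = c u → ∃ r, ℓ r u = z) ∧
      (∀ r, Tendsto (ℓ r) reAtBot (𝓝 (lam r : ℂ))) ∧
      ∀ r, Tendsto (fun u => (ℓ r u : OnePoint ℂ)) reAtTop (𝓝 (d (ρ r))) := by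
  have hc0 : ∀ u, c u ≠ 0 := fun u => ne_zero_of_mem_regularCouplings (hc u)
  have hq : ∀ u z, coupling lam w z = c u → (weightPoly lam w).eval z ≠ 0 := fun u z h =>
    eval_weightPoly_ne_zero_of_coupling_ne_zero (h ▸ hc0 u)
  have cov := isCoveringMapOn_coupling hl hw
  have hlift : ∀ u z, coupling lam w z = c u → ∃ F : C(ℂ, {z : ℂ // (weightPoly lam w).eval z ≠ 0}),
      (F u : ℂ) = z ∧ ∀ v, coupling lam w (F v) = c v := fun u z hz => by
    obtain ⟨F, ⟨h1, h2⟩, -⟩ := cov.existsUnique_continuousMap_lifts c (a₀ := u)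
      (e₀ := ⟨z, hq u z hz⟩) hz hc
    exact ⟨F, congrArg Subtype.val h1, fun v => congrFun h2 v⟩
  have huniq : ∀ (F G : C(ℂ, {z : ℂ // (weightPoly lam w).eval z ≠ 0})),
      (∀ v, coupling lam w (F v) = c v) → (∀ v, coupling lam w (G v) = c v) →
      ∀ u, (F u : ℂ) = G u → F = G := fun F G hF hG u huv =>
    (cov.existsUnique_continuousMap_lifts c (a₀ := u) (e₀ := F u) (hF u) hc).unique
      ⟨rfl, funext hF⟩ ⟨Subtype.ext huv.symm, funext hG⟩
  -- The branches are first indexed by the fiber over `c 0`; they are relabelled by their starting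
  -- poles at the end.
  choose F hF0 hF using fun e : {z | coupling lam w z = c 0} => hlift 0 e e.2
  have hFc : ∀ e, Continuous fun u => ((F e u : ℂ)) := fun e =>
    continuous_subtype_val.comp (F e).continuous
  have hdist : ∀ e e', e ≠ e' → ∀ u, (F e u : ℂ) ≠ F e' u := fun e e' hee u hu =>
    hee (Subtype.ext (by rw [← hF0 e, ← hF0 e', huniq _ _ (hF e) (hF e') u hu]))
  have hsurj : ∀ u z, coupling lam w z = c u → ∃ e, (F e u : ℂ) = z := fun u z hz => by
    obtain ⟨G, hGu, hG⟩ := hlift u z hz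
    refine ⟨⟨G 0, hG 0⟩, ?_⟩
    rw [huniq _ G (hF _) hG 0 (hF0 _), hGu]
  have hgauge : ∀ e, poleGauge lam w ∘ (fun u => ((F e u : ℂ) : OnePoint ℂ)) =
      fun u => (‖c u‖ + 1)⁻¹ := fun e => funext fun u => by
    simp only [Function.comp_apply]
    rw [poleGauge_coe (F e u).2, hF e u]
  have hFc' : ∀ e, Continuous fun u => ((F e u : ℂ) : OnePoint ℂ) := fun e =>
    OnePoint.continuous_coe.comp (hFc e)
  have hfin1 : (poleGauge lam w ⁻¹' {1}).Finite := by
    refine (finite_range fun j => ((lam j : ℂ) : OnePoint ℂ)).subset fun x hx => ?_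
    obtain ⟨j, rfl⟩ := (poleGauge_eq_one_iff hl hw).1 hx
    exact mem_range_self j
  have hfin0 : (poleGauge lam w ⁻¹' {0}).Finite :=
    (finite_range d).subset fun x hx => (hd x).1 hx
  have hstart : ∀ e, ∃ j, Tendsto (fun u => (F e u : ℂ)) reAtBot (𝓝 (lam j : ℂ)) := fun e => by
    obtain ⟨x, hx, hlim⟩ := exists_tendsto_of_tendsto_comp exists_preconnected_mem_reAtBot (hFc' e)
      (continuous_poleGauge hl hw) hfin1 (by
        rw [hgauge e]
        simpa using (hbot.add_const 1).inv₀ (by norm_num))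
    obtain ⟨j, rfl⟩ := (poleGauge_eq_one_iff hl hw).1 hx
    exact ⟨j, (OnePoint.isOpenEmbedding_coe.isInducing.tendsto_nhds_iff).2 hlim⟩
  have hend : ∀ e, ∃ j, Tendsto (fun u => ((F e u : ℂ) : OnePoint ℂ)) reAtTop (𝓝 (d j)) :=
    fun e => by
      obtain ⟨x, hx, hlim⟩ := exists_tendsto_of_tendsto_comp exists_preconnected_mem_reAtTop
        (hFc' e) (continuous_poleGauge hl hw) hfin0 (by
          rw [hgauge e]
          exact tendsto_inv_atTop_zero.comp (tendsto_atTop_add_const_right _ _ htop))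
      obtain ⟨j, rfl⟩ := (hd x).1 hx
      exact ⟨j, hlim⟩
  choose a ha using hstart
  choose b hb using hend
  have hcard : Nat.card {z | coupling lam w z = c 0} = Fintype.card ι := by
    rw [Nat.card_coe_set_eq]
    exact card_coupling_fiber hl hw (hc0 0) (hc 0).2
  have hfib : Finite {z | coupling lam w z = c 0} := finite_coupling_fiber hl hw (hc0 0)
  have hsame : ∀ e e' u, coupling lam w (F e u) = coupling lam w (F e' u) := fun e e' u => by
    rw [hF, hF]
  have hne0 : ∀ e u, coupling lam w (F e u) ≠ 0 := fun e u => by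
    rw [hF]
    exact hc0 u
  have ha' : Function.Injective a := fun e e' hee => by
    by_contra hne
    exact not_tendsto_same_pole hl hw (hsame e e') (hne0 e) (hdist e e' hne) (ha e)
      (hee ▸ ha e')
  have hb' : Function.Injective b := fun e e' hee => by
    by_contra hne
    have h1 := hb e
    have h2 := hb e'
    rw [← hee] at h2
    have hz : poleGauge lam w (d (b e)) = 0 := (hd _).2 (mem_range_self _)
    generalize d (b e) = x at h1 h2 hz
    induction x using OnePoint.rec with
    | infty =>
      have hco : comap ((↑) : ℂ → OnePoint ℂ) (𝓝 OnePoint.infty) = Bornology.cobounded ℂ := by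
        rw [OnePoint.comap_coe_nhds_infty, coclosedCompact_eq_cocompact,
          ← Metric.cobounded_eq_cocompact]
      refine not_tendsto_same_infty hw (hsame e e') (hne0 e) (hdist e e' hne) (L := reAtTop) ?_ ?_
      · rw [← hco]
        exact tendsto_comap_iff.2 h1
      · rw [← hco]
        exact tendsto_comap_iff.2 h2
    | coe z =>
      exact not_tendsto_same_zero hl hw (hsame e e') (hne0 e) (hdist e e' hne)
        ((poleGauge_coe_eq_zero_iff hl hw).1 hz)
        ((OnePoint.isOpenEmbedding_coe.isInducing.tendsto_nhds_iff).2 h1)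
        ((OnePoint.isOpenEmbedding_coe.isInducing.tendsto_nhds_iff).2 h2)
  have hcard' : Nat.card {z | coupling lam w z = c 0} = Nat.card ι := by
    rw [hcard, Nat.card_eq_fintype_card]
  let ea := Equiv.ofBijective a ((Nat.bijective_iff_injective_and_card a).2 ⟨ha', hcard'⟩)
  let eb := Equiv.ofBijective b ((Nat.bijective_iff_injective_and_card b).2 ⟨hb', hcard'⟩)
  refine ⟨fun r => ⟨_, hFc (ea.symm r)⟩, ea.symm.trans eb, fun r u => hF _ u,
    fun r s u hrs => hdist _ _ (ea.symm.injective.ne hrs) u, fun u z hz => ?_, fun r => ?_,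
    fun r => hb _⟩
  · obtain ⟨e, he⟩ := hsurj u z hz
    exact ⟨ea e, by simpa using he⟩
  · have := ha (ea.symm r)
    rwa [show a (ea.symm r) = r from ea.apply_symm_apply r] at this

end Sections

/-! ### From inverse branches to analytic curves -/

section Curves

variable {ι : Type*} [Fintype ι] [DecidableEq ι] {lam w : ι → ℝ}

/-- The angles in `(0, π)` of the rays that contain no critical value of the coupling function. -/
def regularAngles (lam w : ι → ℝ) : Set ℝ :=
  {θ ∈ Ioo 0 Real.pi | ∀ t : ℝ, 0 < t →
    (t : ℂ) * Complex.exp ((θ : ℂ) * Complex.I) ∈ regularCouplings lam w}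

theorem im_ofReal_mul_exp_pos {t θ : ℝ} (ht : 0 < t) (hθ : θ ∈ Ioo 0 Real.pi) :
    0 < ((t : ℂ) * Complex.exp ((θ : ℂ) * Complex.I)).im := by
  rw [Complex.im_ofReal_mul, Complex.exp_ofReal_mul_I_im]
  exact mul_pos ht (Real.sin_pos_of_mem_Ioo hθ)

/-- An excluded angle is the argument of `F` at a root of the Wronskian, a nonzero polynomial. -/
theorem finite_diff_regularAngles [Nonempty ι] (hl : Function.Injective lam)
    (hw : ∀ j, 0 < w j) : (Ioo 0 Real.pi \ regularAngles lam w).Finite := by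
  have hfin : {z | (couplingWronskian lam w).IsRoot z}.Finite :=
    Polynomial.finite_setOfPred_isRoot (couplingWronskian_ne_zero hl hw)
  refine (hfin.image fun z => (coupling lam w z).arg).subset ?_
  rintro θ ⟨hθ, hreg⟩
  simp only [regularAngles, mem_ofPred_eq, not_and, not_forall] at hreg
  obtain ⟨t, ht, h⟩ := hreg hθ
  simp only [regularCouplings, mem_ofPred_eq, not_and, not_forall, not_not] at h
  obtain ⟨z, hz, hz0⟩ := h (im_ofReal_mul_exp_pos ht hθ)
  refine ⟨z, hz0, ?_⟩
  simp only [hz]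
  rw [Complex.arg_real_mul _ ht, Complex.arg_exp_mul_I, toIocMod_eq_self]
  exact ⟨by linarith [hθ.1, Real.pi_pos], by linarith [hθ.2, Real.pi_pos]⟩

/-- Near each `t` a continuous lift of the ray is the analytic local inverse of `F` applied to `t
e^{iθ}`. The derivative cannot vanish, by the chain rule, because the ray has nonzero velocity;
injectivity is inherited from the ray. -/
theorem isSimpleAnalyticCurve_of_coupling [Nonempty ι] (hw : ∀ j, 0 < w j) {θ : ℝ}
    (hθ : θ ∈ regularAngles lam w) {σ : ℝ → ℂ} (hσ : ContinuousOn σ (Ioi 0))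
    (h : ∀ t : ℝ, 0 < t → coupling lam w (σ t) = t * Complex.exp ((θ : ℂ) * Complex.I)) :
    IsSimpleAnalyticCurve σ := by
  have hreg : ∀ t : ℝ, 0 < t → coupling lam w (σ t) ∈ regularCouplings lam w := fun t ht => by
    rw [h t ht]
    exact hθ.2 t ht
  have hq : ∀ t : ℝ, 0 < t → (weightPoly lam w).eval (σ t) ≠ 0 := fun t ht =>
    eval_weightPoly_ne_zero_of_coupling_ne_zero (ne_zero_of_mem_regularCouplings (hreg t ht))
  have hd : ∀ t : ℝ, 0 < t → deriv (coupling lam w) (σ t) ≠ 0 := fun t ht => by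
    rw [(hasStrictDerivAt_coupling (hq t ht)).hasDerivAt.deriv]
    exact div_ne_zero ((hreg t ht).2 _ rfl) (pow_ne_zero 2 (hq t ht))
  have han : ∀ t : ℝ, 0 < t → AnalyticAt ℝ σ t := fun t ht => by
    have hF : AnalyticAt ℂ (coupling lam w) (σ t) :=
      ((nodalPoly lam).differentiable.analyticAt _).div
        ((weightPoly lam w).differentiable.analyticAt _) (hq t ht)
    have hG := hF.analyticAt_localInverse (hd t ht)
    rw [h t ht] at hG
    have hlin : AnalyticAt ℝ (fun s : ℝ => (s : ℂ) * Complex.exp ((θ : ℂ) * Complex.I)) t :=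
      (Complex.ofRealCLM.analyticAt t).mul analyticAt_const
    refine AnalyticAt.congr (AnalyticAt.comp (hG.restrictScalars (𝕜 := ℝ)) hlin) ?_
    have hev := (hσ.continuousAt (Ioi_mem_nhds ht)).eventually
      (hF.hasStrictDerivAt.eventually_left_inverse (hf' := hd t ht))
    filter_upwards [hev, Ioi_mem_nhds ht] with s hs hs0
    rw [Function.comp_apply, ← h s hs0]
    exact hs
  refine ⟨fun t ht => im_pos_of_im_coupling_pos hw (hreg t ht).1, fun t ht s hs hts => ?_,
    fun t ht => han t ht, fun t ht h0 => ?_⟩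
  · have := (h t ht).symm.trans ((congrArg _ hts).trans (h s hs))
    exact_mod_cast mul_right_cancel₀ (Complex.exp_ne_zero _) this
  · have h1 := HasDerivAt.scomp t (hasStrictDerivAt_coupling (hq t ht)).hasDerivAt
      (han t ht).differentiableAt.hasDerivAt
    rw [h0, zero_smul] at h1
    have h2 : HasDerivAt (fun s : ℝ => (s : ℂ) * Complex.exp ((θ : ℂ) * Complex.I))
        (1 * Complex.exp ((θ : ℂ) * Complex.I)) t :=
      (Complex.ofRealCLM.hasDerivAt (x := t)).mul_const _
    have h3 := h1.unique (h2.congr_of_eventuallyEq (by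
      filter_upwards [Ioi_mem_nhds ht] with s hs using h s hs))
    rw [one_mul] at h3
    exact Complex.exp_ne_zero _ h3.symm

/-- The map `u ↦ exp (re u + i φ)`, where `φ` is the projection of `im u` to `[θ₁, θ₂]`. -/
def sectorMap (θ₁ θ₂ : ℝ) (h : θ₁ ≤ θ₂) : C(ℂ, ℂ) where
  toFun u := (Real.exp u.re : ℂ) * Complex.exp (((projIcc θ₁ θ₂ h u.im : ℝ) : ℂ) * Complex.I)
  continuous_toFun := by
    have : Continuous fun u : ℂ => (projIcc θ₁ θ₂ h u.im : ℝ) :=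
      continuous_subtype_val.comp (continuous_projIcc.comp Complex.continuous_im)
    fun_prop

theorem norm_sectorMap {θ₁ θ₂ : ℝ} (h : θ₁ ≤ θ₂) (u : ℂ) :
    ‖sectorMap θ₁ θ₂ h u‖ = Real.exp u.re := by
  simp [sectorMap, Complex.norm_exp_ofReal_mul_I]

theorem sectorMap_log {θ₁ θ₂ : ℝ} (h : θ₁ ≤ θ₂) {t θ : ℝ} (ht : 0 < t) (hθ : θ ∈ Icc θ₁ θ₂) :
    sectorMap θ₁ θ₂ h ⟨Real.log t, θ⟩ = t * Complex.exp ((θ : ℂ) * Complex.I) := by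
  simp [sectorMap, projIcc_of_mem h hθ, Real.exp_log ht, -Complex.ofReal_exp]

theorem exists_perm_forall_Icc [Nonempty ι] (hl : Function.Injective lam) (hw : ∀ j, 0 < w j)
    {d : ι → OnePoint ℂ} (hd : ∀ x, poleGauge lam w x = 0 ↔ x ∈ range d) {θ₁ θ₂ : ℝ}
    (h12 : θ₁ ≤ θ₂) (hreg : Icc θ₁ θ₂ ⊆ regularAngles lam w) :
    ∃ ρ : Equiv.Perm ι, ∀ θ ∈ Icc θ₁ θ₂, ∃ σ : ι → ℝ → ℂ,
      (∀ r, IsSimpleAnalyticCurve (σ r)) ∧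
      (∀ r s, r ≠ s → Disjoint (σ r '' Ioi 0) (σ s '' Ioi 0)) ∧
      {z | ∃ t : ℝ, 0 < t ∧ coupling lam w z = t * Complex.exp ((θ : ℂ) * Complex.I)} =
        ⋃ r, σ r '' Ioi 0 ∧
      (∀ r, Tendsto (σ r) (𝓝[>] 0) (𝓝 (lam r : ℂ))) ∧
      ∀ r, Tendsto (fun t => (σ r t : OnePoint ℂ)) atTop (𝓝 (d (ρ r))) := by
  -- Clamping the imaginary part extends the logarithmic parametrization of the closed sector to the
  -- whole plane; the ray of angle `θ` is the horizontal line at height `θ`.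
  obtain ⟨ℓ, ρ, hℓ, hdist, hsurj, hstart, hend⟩ := exists_sections hl hw hd (sectorMap θ₁ θ₂ h12)
    (fun u => (hreg (projIcc θ₁ θ₂ h12 u.im).2).2 _ (Real.exp_pos _))
    (by simp only [norm_sectorMap]; exact Real.tendsto_exp_atBot.comp tendsto_comap)
    (by simp only [norm_sectorMap]; exact Real.tendsto_exp_atTop.comp tendsto_comap)
  refine ⟨ρ, fun θ hθ => ⟨fun r t => ℓ r ⟨Real.log t, θ⟩, fun r => ?_, fun r s hrs => ?_, ?_,
    fun r => ?_, fun r => ?_⟩⟩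
  · refine isSimpleAnalyticCurve_of_coupling hw (hreg hθ) ?_ fun t ht => by
      rw [hℓ, sectorMap_log h12 ht hθ]
    refine (ℓ r).continuous.comp_continuousOn ?_
    have hlog : ContinuousOn Real.log (Ioi 0) := Real.continuousOn_log.mono fun t ht => ne_of_gt ht
    have h2 : ContinuousOn (fun t : ℝ => (Real.log t : ℂ) + θ * Complex.I) (Ioi 0) :=
      (Complex.continuous_ofReal.comp_continuousOn hlog).add continuousOn_const
    refine h2.congr fun t _ => ?_
    apply Complex.ext <;> simp
  · rw [disjoint_left]
    rintro _ ⟨t, ht, rfl⟩ ⟨s', hs', hts⟩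
    have h1 := congrArg (coupling lam w) hts
    rw [hℓ, hℓ, sectorMap_log h12 hs' hθ, sectorMap_log h12 ht hθ] at h1
    have h2 : s' = t := by exact_mod_cast mul_right_cancel₀ (Complex.exp_ne_zero _) h1
    subst h2
    exact hdist r s _ hrs hts.symm
  · ext z
    simp only [mem_ofPred_eq, mem_iUnion, mem_image, mem_Ioi]
    constructor
    · rintro ⟨t, ht, hz⟩
      rw [← sectorMap_log h12 ht hθ] at hz
      obtain ⟨r, hr⟩ := hsurj _ z hz
      exact ⟨r, t, ht, hr⟩
    · rintro ⟨r, t, ht, rfl⟩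
      exact ⟨t, ht, by rw [hℓ, sectorMap_log h12 ht hθ]⟩
  · exact (hstart r).comp (tendsto_comap_iff.2 Real.tendsto_log_nhdsGT_zero)
  · exact (hend r).comp (tendsto_comap_iff.2 Real.tendsto_log_atTop)

end Curves

/-! ### Rigidity of decompositions into arcs -/

section Uniqueness

variable {X : Type*} [TopologicalSpace X] [T2Space X]

/-- Near both ends the arc is close to `a` or `b`, and the remaining piece is compact, so nothing
else is added by the closure. -/
theorem closure_image_Ioi_subset {f : ℝ → X} (hf : ContinuousOn f (Ioi 0)) {a b : X}
    (ha : Tendsto f (𝓝[>] 0) (𝓝 a)) (hb : Tendsto f atTop (𝓝 b)) :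
    closure (f '' Ioi 0) ⊆ f '' Ioi 0 ∪ {a, b} := by
  intro x hx
  by_contra hcon
  simp only [mem_union, mem_insert_iff, mem_singleton_iff, not_or] at hcon
  obtain ⟨hxf, hxa, hxb⟩ := hcon
  obtain ⟨U, V, hU, hV, hxU, haV, hUV⟩ := t2_separation hxa
  obtain ⟨U', V', hU', hV', hxU', hbV', hUV'⟩ := t2_separation hxb
  obtain ⟨ε, hε, hεV⟩ := (nhdsGT_basis (0 : ℝ)).mem_iff.1 (ha (hV.mem_nhds haV))
  obtain ⟨M, hM⟩ := (atTop_basis.mem_iff.1 (hb (hV'.mem_nhds hbV')))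
  have hK : IsClosed (f '' Icc ε M) :=
    (isCompact_Icc.image_of_continuousOn (hf.mono fun t ht => lt_of_lt_of_le hε ht.1)).isClosed
  have hmem : U ∩ U' ∩ (f '' Icc ε M)ᶜ ∈ 𝓝 x :=
    (((hU.inter hU').inter hK.isOpen_compl).mem_nhds ⟨⟨hxU, hxU'⟩, fun h =>
      hxf (image_mono (fun t ht => lt_of_lt_of_le hε ht.1) h)⟩)
  obtain ⟨_, ⟨⟨h1, h2⟩, h3⟩, t, ht, rfl⟩ := mem_closure_iff_nhds.1 hx _ hmem
  rcases lt_or_ge t ε with hlt | hge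
  · exact disjoint_left.1 hUV h1 (hεV ⟨ht, hlt⟩)
  · rcases le_or_gt M t with hle | hgt
    · exact disjoint_left.1 hUV' h2 (hM.2 hle)
    · exact h3 ⟨t, ⟨hge, hgt.le⟩, rfl⟩

/-- Two decompositions of a set into disjoint arcs with the same starting points `a r` outside the
set join them to the same end points. -/
theorem end_eq_of_iUnion_eq {ι : Type*} [Finite ι] {f f' : ι → ℝ → X} {a b b' : ι → X}
    (hf : ∀ r, ContinuousOn (f r) (Ioi 0)) (hf' : ∀ r, ContinuousOn (f' r) (Ioi 0))
    (hdisj : ∀ r s, r ≠ s → Disjoint (f r '' Ioi 0) (f s '' Ioi 0))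
    (hunion : ∀ r, f' r '' Ioi 0 ⊆ ⋃ s, f s '' Ioi 0)
    (ha : ∀ r, Tendsto (f r) (𝓝[>] 0) (𝓝 (a r))) (hb : ∀ r, Tendsto (f r) atTop (𝓝 (b r)))
    (ha' : ∀ r, Tendsto (f' r) (𝓝[>] 0) (𝓝 (a r)))
    (hb' : ∀ r, Tendsto (f' r) atTop (𝓝 (b' r)))
    (hainj : Function.Injective a) (hab : ∀ r s, a r ≠ b s) (hab' : ∀ r s, a r ≠ b' s)
    (haf : ∀ r s, a r ∉ f s '' Ioi 0) (hbf : ∀ r s, b r ∉ f s '' Ioi 0)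
    (hbf' : ∀ r s, b' r ∉ f s '' Ioi 0) (r : ι) : b' r = b r := by
  have hcl : ∀ s, closure (f s '' Ioi 0) ⊆ f s '' Ioi 0 ∪ {a s, b s} := fun s =>
    closure_image_Ioi_subset (hf s) (ha s) (hb s)
  set D : Set X := ⋃ s ∈ {s | s ≠ r}, closure (f s '' Ioi 0) with hD
  have hDc : IsClosed D := (Set.toFinite _).isClosed_biUnion fun s _ => isClosed_closure
  have hrange : ∀ x ∈ ⋃ s, f s '' Ioi 0, ∀ s, x ∈ closure (f s '' Ioi 0) → x ∈ f s '' Ioi 0 := by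
    intro x hx s hxs
    obtain ⟨s', hs'⟩ := mem_iUnion.1 hx
    rcases hcl s hxs with h | h
    · exact h
    · rcases h with rfl | h
      · exact absurd hs' (haf s s')
      · rw [mem_singleton_iff] at h
        subst h
        exact absurd hs' (hbf s s')
  have haD : a r ∉ D := by
    rw [hD]
    simp only [mem_iUnion, not_exists]
    intro s hs h
    rcases hcl s h with h | h | h
    · exact haf r s h
    · exact hs (hainj h).symm
    · exact hab r s h
  have hmem : ∀ t, 0 < t → f' r t ∈ ⋃ s, f s '' Ioi 0 := fun t ht =>
    hunion r (mem_image_of_mem _ ht)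
  -- On the union, the closure of the arc `f r` and the union `D` of the other closures are disjoint
  -- closed sets. The connected arc `f' r` lies in one of them, and `D` is ruled out since it misses
  -- the starting point `a r`.
  have hsub : f' r '' Ioi 0 ⊆ closure (f r '' Ioi 0) := by
    have hpre : IsPreconnected (f' r '' Ioi 0) := isPreconnected_Ioi.image _ (hf' r)
    refine ((isPreconnected_iff_subset_of_disjoint_closed.1 hpre) _ D isClosed_closure hDc ?_ ?_
      ).resolve_right fun hcon => ?_
    · rintro _ ⟨t, ht, rfl⟩
      obtain ⟨s, hs⟩ := mem_iUnion.1 (hmem t ht)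
      by_cases h : s = r
      · exact Or.inl (subset_closure (h ▸ hs))
      · exact Or.inr (mem_biUnion (x := s) h (subset_closure hs))
    · rw [eq_empty_iff_forall_notMem]
      rintro _ ⟨⟨t, ht, rfl⟩, h1, h2⟩
      obtain ⟨s, hs, h2⟩ := mem_iUnion₂.1 h2
      exact disjoint_left.1 (hdisj r s (Ne.symm hs)) (hrange _ (hmem t ht) r h1)
        (hrange _ (hmem t ht) s h2)
    · exact haD (hDc.mem_of_tendsto (ha' r)
        (eventually_nhdsWithin_of_forall fun t ht => hcon (mem_image_of_mem _ ht)))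
  have hbcl : b' r ∈ closure (f r '' Ioi 0) := isClosed_closure.mem_of_tendsto (hb' r)
    ((eventually_gt_atTop 0).mono fun t ht => hsub (mem_image_of_mem _ ht))
  rcases hcl r hbcl with h | h | h
  · exact absurd h (hbf' r r)
  · exact absurd h.symm (hab' r r)
  · exact h

end Uniqueness

/-! ### Spectral equations for the perturbed and truncated operators -/

variable {H : Type*} [NormedAddCommGroup H] [InnerProductSpace ℂ H]

section Operator

variable {A : H →ₗ[ℂ] H} {e : H}

theorem IsCyclicVector.ne_zero (he : IsCyclicVector A e) : e ≠ 0 := by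
  rintro rfl
  simpa using he.norm_eq_one

/-- An eigenvector of a symmetric operator is not orthogonal to a cyclic vector. -/
theorem IsCyclicVector.eq_zero_of_inner_eq_zero (he : IsCyclicVector A e) (hA : A.IsSymmetric)
    {μ : ℂ} {f : H} (hf : A f = μ • f) (h0 : inner ℂ e f = 0) : f = 0 := by
  have hpow : ∀ n : ℕ, inner ℂ (((A : Module.End ℂ H) ^ n) e) f = 0 := by
    intro n
    induction n with
    | zero => simpa using h0
    | succ n ih =>
      rw [pow_succ', Module.End.mul_apply, hA, hf, inner_smul_right, ih, mul_zero]
  have hall : ∀ x : H, inner ℂ x f = 0 := fun x => by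
    have hx : x ∈ Submodule.span ℂ (range fun n : ℕ => ((A : Module.End ℂ H) ^ n) e) := by
      rw [he.span_eq_top]
      trivial
    induction hx using Submodule.span_induction with
    | mem x hx =>
      obtain ⟨n, rfl⟩ := hx
      exact hpow n
    | zero => simp
    | add x y _ _ hx hy => rw [inner_add_left, hx, hy, add_zero]
    | smul a x _ hx => rw [inner_smul_left, hx, mul_zero]
  exact inner_self_eq_zero.1 (hall f)

/-- A linear functional that kills no eigenvector is injective on every eigenspace, so all
eigenvalues are simple. -/
theorem incEigenvalues_injective {V : Type*} [NormedAddCommGroup V] [InnerProductSpace ℂ V]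
    [FiniteDimensional ℂ V] {T : V →ₗ[ℂ] V} (hT : T.IsSymmetric) (L : V →ₗ[ℂ] ℂ)
    (hL : ∀ (μ : ℂ) (f : V), T f = μ • f → L f = 0 → f = 0) :
    Function.Injective (incEigenvalues hT) := by
  have key : ∀ i j, hT.eigenvalues rfl i = hT.eigenvalues rfl j → i = j := by
    intro i j hij
    have hcard := hT.card_filter_eigenvalues_eq rfl ((hT.eigenvalues rfl j : ℝ) : ℂ)
    have hle : finrank ℂ (Module.End.eigenspace T ((hT.eigenvalues rfl j : ℝ) : ℂ)) ≤ 1 := by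
      have hinj : Function.Injective (L ∘ₗ
          (Module.End.eigenspace T ((hT.eigenvalues rfl j : ℝ) : ℂ)).subtype) := by
        rw [← LinearMap.ker_eq_bot, LinearMap.ker_eq_bot']
        rintro ⟨f, hf⟩ h
        exact Subtype.ext (hL _ f (Module.End.mem_eigenspace_iff.1 hf) h)
      simpa using LinearMap.finrank_le_finrank_of_injective hinj
    rw [← hcard, Finset.card_le_one] at hle
    exact hle i (by simp [hij]) j (by simp)
  intro r s hrs
  exact Fin.rev_injective (key _ _ hrs)

theorem hasEigenvalue_incEigenvalues {V : Type*} [NormedAddCommGroup V] [InnerProductSpace ℂ V]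
    [FiniteDimensional ℂ V] {T : V →ₗ[ℂ] V} (hT : T.IsSymmetric) (r : Fin (finrank ℂ V)) :
    Module.End.HasEigenvalue T ((incEigenvalues hT r : ℝ) : ℂ) :=
  hT.hasEigenvalue_eigenvalues rfl r.rev

theorem exists_incEigenvalues_eq {V : Type*} [NormedAddCommGroup V] [InnerProductSpace ℂ V]
    [FiniteDimensional ℂ V] {T : V →ₗ[ℂ] V} (hT : T.IsSymmetric) {μ : ℂ}
    (hμ : Module.End.HasEigenvalue T μ) : ∃ r, ((incEigenvalues hT r : ℝ) : ℂ) = μ := by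
  obtain ⟨i, hi⟩ := hT.exists_eigenvalues_eq rfl hμ
  exact ⟨i.rev, by simpa [incEigenvalues] using hi⟩

/-- The eigenvalue equation after projection holds modulo `(e^⊥)^⊥`, the span of `e`. It thus takes
the same form `(δ - A) f = c e` as the equation for the perturbed operator. -/
theorem truncation_apply_eq_smul_iff {f : ((Submodule.span ℂ {e})ᗮ : Submodule ℂ H)} {δ : ℂ} :
    truncation A (Submodule.span ℂ {e})ᗮ f = δ • f ↔ ∃ c : ℂ, δ • (f : H) - A f = c • e := by
  have hin : ∀ y : ((Submodule.span ℂ {e})ᗮ : Submodule ℂ H),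
      inner ℂ y (truncation A (Submodule.span ℂ {e})ᗮ f) = inner ℂ (y : H) (A f) := fun y => by
    simp [truncation]
  constructor
  · intro h
    have hmem : δ • (f : H) - A f ∈ (Submodule.span ℂ {e})ᗮᗮ := by
      rw [Submodule.mem_orthogonal]
      intro y hy
      have := hin ⟨y, hy⟩
      rw [h] at this
      rw [inner_sub_right, ← this, inner_smul_right, inner_smul_right]
      exact sub_self _
    rw [Submodule.orthogonal_orthogonal, Submodule.mem_span_singleton] at hmem
    obtain ⟨c, hc⟩ := hmem
    exact ⟨c, hc.symm⟩
  · rintro ⟨c, hc⟩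
    refine ext_inner_left ℂ fun y => ?_
    have hy : inner ℂ (y : H) e = 0 := by
      rw [← inner_conj_symm, Submodule.mem_orthogonal_singleton_iff_inner_right.1 y.2, map_zero]
    have h2 : A f = δ • (f : H) - c • e := by rw [← hc]; abel
    rw [hin, h2, inner_sub_right, inner_smul_right, inner_smul_right, hy, inner_smul_right,
      mul_zero, sub_zero]
    rfl

section Eigenbasis

variable {ι : Type*} [Fintype ι] {lam : ι → ℝ} {b : OrthonormalBasis ι ℂ H}

theorem inner_basis_apply (hA : A.IsSymmetric) (hb : ∀ j, A (b j) = (lam j : ℂ) • b j) (j : ι)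
    (f : H) : inner ℂ (b j) (A f) = lam j * inner ℂ (b j) f := by
  rw [← hA, hb, inner_smul_left, Complex.conj_ofReal]

theorem ne_eigenvalue_of_smul_sub_apply (hA : A.IsSymmetric)
    (hb : ∀ j, A (b j) = (lam j : ℂ) • b j) (hne : ∀ j, inner ℂ (b j) e ≠ 0) {z c : ℂ} {f : H}
    (h : z • f - A f = c • e) (hc : c ≠ 0) (j : ι) : z ≠ lam j := by
  rintro rfl
  have := congrArg (inner ℂ (b j)) h
  rw [inner_sub_right, inner_smul_right, inner_smul_right, inner_basis_apply hA hb, sub_self,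
    eq_comm, mul_eq_zero] at this
  exact this.elim hc (hne j)

theorem inner_eq_mul_poleSum (hA : A.IsSymmetric)
    (hb : ∀ j, A (b j) = (lam j : ℂ) • b j) {z c : ℂ} {f : H}
    (h : z • f - A f = c • e) (hz : ∀ j, z ≠ lam j) :
    inner ℂ e f = c * poleSum lam (fun j => ‖inner ℂ (b j) e‖ ^ 2) z := by
  rw [← b.sum_inner_mul_inner e f, poleSum, Finset.mul_sum]
  refine Finset.sum_congr rfl fun j _ => ?_
  have h1 := congrArg (inner ℂ (b j)) h
  rw [inner_sub_right, inner_smul_right, inner_smul_right, inner_basis_apply hA hb] at h1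
  have h2 := sub_ne_zero.2 (hz j)
  have h3 : inner ℂ e (b j) * inner ℂ (b j) e = ((‖inner ℂ (b j) e‖ ^ 2 : ℝ) : ℂ) := by
    rw [← inner_conj_symm e (b j), Complex.conj_mul']
    push_cast
    rfl
  have h4 : inner ℂ (b j) f = c * inner ℂ (b j) e / (z - lam j) := by
    rw [eq_div_iff h2, ← h1]
    ring
  rw [h4, ← h3]
  ring

theorem exists_smul_sub_apply_eq (hb : ∀ j, A (b j) = (lam j : ℂ) • b j)
    {z : ℂ} (hz : ∀ j, z ≠ lam j) : ∃ f : H, z • f - A f = e := by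
  refine ⟨∑ j, (inner ℂ (b j) e / (z - lam j)) • b j, ?_⟩
  rw [map_sum, Finset.smul_sum, ← Finset.sum_sub_distrib]
  conv_rhs => rw [← b.sum_repr' e]
  refine Finset.sum_congr rfl fun j _ => ?_
  rw [map_smul, hb, smul_smul, smul_smul, ← sub_smul]
  have h2 := sub_ne_zero.2 (hz j)
  congr 1
  field_simp

variable [DecidableEq ι]

/-- An eigenvector `f` solves `(z - A) f = γ ⟨f, e⟩ e` with `⟨f, e⟩ ≠ 0` by cyclicity; pairing with
`e` gives `γ * poleSum = 1`. Conversely `(z - A)⁻¹ e` is an eigenvector. -/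
theorem mem_spectrum_perturbed_iff [FiniteDimensional ℂ H] (hA : A.IsSymmetric)
    (he : IsCyclicVector A e)
    (hb : ∀ j, A (b j) = (lam j : ℂ) • b j) (hne : ∀ j, inner ℂ (b j) e ≠ 0) {γ z : ℂ}
    (hγ : γ ≠ 0) : z ∈ spectrum ℂ (perturbed A e γ : Module.End ℂ H) ↔
      coupling lam (fun j => ‖inner ℂ (b j) e‖ ^ 2) z = γ := by
  have happ : ∀ f, perturbed A e γ f = A f + (γ * inner ℂ e f) • e := fun f => by
    simp [perturbed, rankOneOp_apply, smul_smul]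
  rw [← Module.End.hasEigenvalue_iff_mem_spectrum]
  constructor
  · intro h
    obtain ⟨f, hf⟩ := h.exists_hasEigenvector
    have h1 := hf.apply_eq_smul
    rw [happ] at h1
    have h2 : z • f - A f = (γ * inner ℂ e f) • e := by rw [← h1]; abel
    have h3 : inner ℂ e f ≠ 0 := fun h0 => hf.2 (he.eq_zero_of_inner_eq_zero hA (μ := z)
      (by rw [← h1, h0]; simp) h0)
    have hz := ne_eigenvalue_of_smul_sub_apply hA hb hne h2 (mul_ne_zero hγ h3)
    have h4 := inner_eq_mul_poleSum hA hb h2 hz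
    rw [coupling_eq_inv_poleSum hz]
    refine inv_eq_of_mul_eq_one_left ?_
    refine mul_right_cancel₀ h3 ?_
    rw [one_mul]
    linear_combination -h4
  · intro h
    have hz := ne_pole_of_coupling_ne_zero (h ▸ hγ)
    rw [coupling_eq_inv_poleSum hz] at h
    obtain ⟨f, hf⟩ := exists_smul_sub_apply_eq (e := e) hb hz
    have h1 := inner_eq_mul_poleSum hA hb (c := 1) (by rw [hf, one_smul]) hz
    have hR : poleSum lam (fun j => ‖inner ℂ (b j) e‖ ^ 2) z ≠ 0 := fun h0 => hγ (by
      rw [← h, h0, inv_zero])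
    refine Module.End.hasEigenvalue_of_hasEigenvector (x := f)
      ⟨Module.End.mem_eigenspace_iff.2 ?_, fun h0 => he.ne_zero (by rw [← hf, h0]; simp)⟩
    rw [happ, h1, one_mul, ← h, inv_mul_cancel₀ hR, one_smul, ← hf]
    abel

/-- Here `(δ - A) f = c e` with `c ≠ 0` by cyclicity, and orthogonality of `f` to `e` says that
`poleSum` vanishes at `δ`. -/
theorem hasEigenvalue_truncation_iff (hA : A.IsSymmetric)
    (he : IsCyclicVector A e)
    (hb : ∀ j, A (b j) = (lam j : ℂ) • b j) (hne : ∀ j, inner ℂ (b j) e ≠ 0)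
    (hl : Function.Injective lam) {δ : ℂ} :
    Module.End.HasEigenvalue (truncation A (Submodule.span ℂ {e})ᗮ) δ ↔
      (weightPoly lam (fun j => ‖inner ℂ (b j) e‖ ^ 2)).eval δ = 0 := by
  have hw : ∀ j, 0 < ‖inner ℂ (b j) e‖ ^ 2 := fun j => pow_pos (norm_pos_iff.2 (hne j)) 2
  constructor
  · intro h
    obtain ⟨f, hf⟩ := h.exists_hasEigenvector
    obtain ⟨c, hc⟩ := truncation_apply_eq_smul_iff.1 hf.apply_eq_smul
    have hef : inner ℂ e (f : H) = 0 := Submodule.mem_orthogonal_singleton_iff_inner_right.1 f.2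
    have hc0 : c ≠ 0 := by
      rintro rfl
      rw [zero_smul, sub_eq_zero] at hc
      exact hf.2 (Subtype.ext (he.eq_zero_of_inner_eq_zero hA hc.symm hef))
    have hz := ne_eigenvalue_of_smul_sub_apply hA hb hne hc hc0
    have h4 := inner_eq_mul_poleSum hA hb hc hz
    rw [hef, eq_comm, mul_eq_zero, or_iff_right hc0] at h4
    rw [eval_weightPoly_eq_mul hz, h4, mul_zero]
  · intro h
    have hz : ∀ j, δ ≠ lam j := by
      rintro j rfl
      exact eval_weightPoly_pole_ne_zero hl hw j h
    have hp := eval_nodalPoly_ne_zero_of_eval_weightPoly_eq_zero hl hw h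
    rw [eval_weightPoly_eq_mul hz, mul_eq_zero, or_iff_right hp] at h
    obtain ⟨f, hf⟩ := exists_smul_sub_apply_eq (e := e) hb hz
    have h1 := inner_eq_mul_poleSum hA hb (c := 1) (by rw [hf, one_smul]) hz
    rw [h, mul_zero] at h1
    refine Module.End.hasEigenvalue_of_hasEigenvector
      (x := (⟨f, Submodule.mem_orthogonal_singleton_iff_inner_right.2 h1⟩ :
        ((Submodule.span ℂ {e})ᗮ : Submodule ℂ H)))
      ⟨Module.End.mem_eigenspace_iff.2 (truncation_apply_eq_smul_iff.2 ⟨1, ?_⟩), fun h0 => ?_⟩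
    · rw [one_smul]
      exact hf
    · have hf0 : f = 0 := congrArg Subtype.val h0
      exact he.ne_zero (by rw [← hf, hf0]; simp)

end Eigenbasis

section EndPoints

variable [FiniteDimensional ℂ H]

theorem finrank_orthogonal_add_one (he : e ≠ 0) :
    finrank ℂ ((Submodule.span ℂ {e})ᗮ : Submodule ℂ H) + 1 = finrank ℂ H := by
  rw [← Submodule.finrank_add_finrank_orthogonal (Submodule.span ℂ {e}),
    finrank_span_singleton he, add_comm]

theorem endPoint_ne_coe (hA : A.IsSymmetric) (r : Fin (finrank ℂ H)) {z : ℂ} (hz : 0 < z.im) :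
    endPoint hA e r ≠ z := by
  unfold endPoint
  split_ifs with h
  · intro h1
    rw [← OnePoint.coe_injective h1] at hz
    simp at hz
  · exact OnePoint.infty_ne_coe z

theorem endPoint_injective (hA : A.IsSymmetric) (he : IsCyclicVector A e) :
    Function.Injective (endPoint hA e) := by
  have hfr := finrank_orthogonal_add_one he.ne_zero
  have hinj : Function.Injective
      (incEigenvalues (truncation_isSymmetric hA (Submodule.span ℂ {e})ᗮ)) := by
    -- The functional is `f ↦ ⟨A f, e⟩`. If it vanishes on an eigenvector of the truncation, then `c
    -- = 0`, so `f` is an eigenvector of `A` orthogonal to `e`, against cyclicity.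
    refine incEigenvalues_injective _ ((innerSL ℂ e : H →ₗ[ℂ] ℂ) ∘ₗ A ∘ₗ Submodule.subtype _) ?_
    intro μ f hf h0
    obtain ⟨c, hc⟩ := truncation_apply_eq_smul_iff.1 hf
    have hef : inner ℂ e (f : H) = 0 := Submodule.mem_orthogonal_singleton_iff_inner_right.1 f.2
    have h1 : inner ℂ e (A f) = 0 := h0
    have h2 := congrArg (inner ℂ e) hc
    rw [inner_sub_right, inner_smul_right, hef, h1, mul_zero, sub_zero, inner_smul_right,
      inner_self_eq_norm_sq_to_K, he.norm_eq_one] at h2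
    have hc0 : c = 0 := by simpa using h2.symm
    rw [hc0, zero_smul, sub_eq_zero] at hc
    exact Subtype.ext (he.eq_zero_of_inner_eq_zero hA hc.symm hef)
  intro r s hrs
  unfold endPoint at hrs
  split_ifs at hrs with h1 h2 h2
  · have := hinj (Complex.ofReal_injective (OnePoint.coe_injective hrs))
    exact Fin.ext (Fin.mk.inj_iff.1 this)
  · exact absurd hrs (OnePoint.coe_ne_infty _)
  · exact absurd hrs (OnePoint.infty_ne_coe _)
  · exact Fin.ext (by omega)

theorem mem_range_endPoint_iff (hA : A.IsSymmetric) (he : IsCyclicVector A e) {x : OnePoint ℂ} :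
    x ∈ range (endPoint hA e) ↔ x = OnePoint.infty ∨
      ∃ z : ℂ, x = z ∧ Module.End.HasEigenvalue (truncation A (Submodule.span ℂ {e})ᗮ) z := by
  have hfr := finrank_orthogonal_add_one he.ne_zero
  constructor
  · rintro ⟨r, rfl⟩
    unfold endPoint
    split_ifs with h
    · exact Or.inr ⟨_, rfl, hasEigenvalue_incEigenvalues _ _⟩
    · exact Or.inl rfl
  · rintro (rfl | ⟨z, rfl, hz⟩)
    · refine ⟨⟨finrank ℂ ((Submodule.span ℂ {e})ᗮ : Submodule ℂ H), by omega⟩, ?_⟩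
      simp [endPoint]
    · obtain ⟨i, hi⟩ := exists_incEigenvalues_eq
        (truncation_isSymmetric hA (Submodule.span ℂ {e})ᗮ) hz
      refine ⟨⟨i, by omega⟩, ?_⟩
      rw [endPoint, dif_pos i.2, ← hi]

end EndPoints

end Operator

/-! ### The decomposition theorem -/

section Decomposition

variable [FiniteDimensional ℂ H] {A : H →ₗ[ℂ] H} {e : H}

theorem IsCyclicVector.incEigenvalues_injective (he : IsCyclicVector A e) (hA : A.IsSymmetric) :
    Function.Injective (incEigenvalues hA) :=
  RankOnePerturbation.incEigenvalues_injective hA (innerSL ℂ e : H →ₗ[ℂ] ℂ) fun _ _ hf h0 =>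
    he.eq_zero_of_inner_eq_zero hA hf h0

/-- An orthonormal basis of eigenvectors, in increasing order of the eigenvalues. -/
def incEigenvectorBasis (hA : A.IsSymmetric) : OrthonormalBasis (Fin (finrank ℂ H)) ℂ H :=
  (hA.eigenvectorBasis rfl).reindex Fin.revPerm

theorem apply_incEigenvectorBasis (hA : A.IsSymmetric) (r : Fin (finrank ℂ H)) :
    A (incEigenvectorBasis hA r) = ((incEigenvalues hA r : ℝ) : ℂ) • incEigenvectorBasis hA r := by
  simp [incEigenvectorBasis, incEigenvalues]

theorem IsCyclicVector.inner_incEigenvectorBasis_ne_zero (he : IsCyclicVector A e)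
    (hA : A.IsSymmetric) (r : Fin (finrank ℂ H)) : inner ℂ (incEigenvectorBasis hA r) e ≠ 0 := by
  intro h
  refine (incEigenvectorBasis hA).orthonormal.ne_zero r
    (he.eq_zero_of_inner_eq_zero hA (apply_incEigenvectorBasis hA r) ?_)
  rw [← inner_conj_symm, h, map_zero]

/-- The weights `|⟨e, e_r⟩|²`, where `e_r` are the normalized eigenvectors. -/
def spectralWeight (hA : A.IsSymmetric) (e : H) (r : Fin (finrank ℂ H)) : ℝ :=
  ‖inner ℂ (incEigenvectorBasis hA r) e‖ ^ 2

theorem IsCyclicVector.spectralWeight_pos (he : IsCyclicVector A e) (hA : A.IsSymmetric)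
    (r : Fin (finrank ℂ H)) : 0 < spectralWeight hA e r :=
  pow_pos (norm_pos_iff.2 (he.inner_incEigenvectorBasis_ne_zero hA r)) 2

theorem poleGauge_eq_zero_iff_mem_range_endPoint (he : IsCyclicVector A e) (hA : A.IsSymmetric)
    (x : OnePoint ℂ) : poleGauge (incEigenvalues hA) (spectralWeight hA e) x = 0 ↔
      x ∈ range (endPoint hA e) := by
  rw [mem_range_endPoint_iff hA he]
  induction x using OnePoint.rec with
  | infty => simp [poleGauge]
  | coe z =>
    rw [poleGauge_coe_eq_zero_iff (he.incEigenvalues_injective hA) (he.spectralWeight_pos hA)]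
    simp [hasEigenvalue_truncation_iff hA he (apply_incEigenvectorBasis hA)
      (he.inner_incEigenvectorBasis_ne_zero hA) (he.incEigenvalues_injective hA)]
    rfl

theorem spectralSet_eq (he : IsCyclicVector A e) (hA : A.IsSymmetric) (θ : ℝ) :
    spectralSet A e θ = {z | ∃ t : ℝ, 0 < t ∧
      coupling (incEigenvalues hA) (spectralWeight hA e) z =
        t * Complex.exp ((θ : ℂ) * Complex.I)} := by
  ext z
  simp only [spectralSet, mem_iUnion, mem_ofPred_eq, mem_Ioi, exists_prop]
  refine exists_congr fun t => and_congr_right fun ht => ?_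
  exact mem_spectrum_perturbed_iff hA he (apply_incEigenvectorBasis hA)
      (he.inner_incEigenvectorBasis_ne_zero hA)
      (mul_ne_zero (Complex.ofReal_ne_zero.2 ht.ne') (Complex.exp_ne_zero _))

theorem endPoint_ne_incEigenvalues (he : IsCyclicVector A e) (hA : A.IsSymmetric)
    (r s : Fin (finrank ℂ H)) :
    (((incEigenvalues hA r : ℝ) : ℂ) : OnePoint ℂ) ≠ endPoint hA e s := by
  intro h
  have h0 := (poleGauge_eq_zero_iff_mem_range_endPoint he hA _).2 (mem_range_self s)
  have h1 := (poleGauge_eq_one_iff (he.incEigenvalues_injective hA)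
    (he.spectralWeight_pos hA)).2 ⟨r, rfl⟩
  rw [h, h0] at h1
  exact zero_ne_one h1

/-- The curves are compared in the Riemann sphere, where every end point exists. Start and end
points are real or `∞`, so they lie off all curves, and no `lam r` is an end point. -/
theorem IsSpectralPermutation.unique (he : IsCyclicVector A e) {hA : A.IsSymmetric} {θ : ℝ}
    {ρ ρ' : Equiv.Perm (Fin (finrank ℂ H))} (h : IsSpectralPermutation hA e θ ρ)
    (h' : IsSpectralPermutation hA e θ ρ') : ρ' = ρ := by
  obtain ⟨σ, hσ, hdisj, hun, hst, hen⟩ := h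
  obtain ⟨σ', hσ', -, hun', hst', hen'⟩ := h'
  have hcont : ∀ {f : ℝ → ℂ}, IsSimpleAnalyticCurve f →
      ContinuousOn (fun t => (f t : OnePoint ℂ)) (Ioi 0) := fun hf =>
    OnePoint.continuous_coe.comp_continuousOn hf.analytic.continuousOn
  have himg : ∀ f : ℝ → ℂ, (fun t => (f t : OnePoint ℂ)) '' Ioi 0 =
      ((↑) : ℂ → OnePoint ℂ) '' (f '' Ioi 0) := fun f => by rw [image_image]
  have hcoe : ∀ {f : ℝ → ℂ} {a : ℂ}, Tendsto f (𝓝[>] 0) (𝓝 a) →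
      Tendsto (fun t => (f t : OnePoint ℂ)) (𝓝[>] 0) (𝓝 (a : OnePoint ℂ)) := fun hf =>
    (OnePoint.continuous_coe.tendsto _).comp hf
  have hb : ∀ r s, endPoint hA e r ∉ (fun t => (σ s t : OnePoint ℂ)) '' Ioi 0 := by
    rintro r s ⟨t, ht, h⟩
    exact endPoint_ne_coe hA r ((hσ s).im_pos t ht) h.symm
  refine Equiv.ext fun r => endPoint_injective hA he ?_
  refine end_eq_of_iUnion_eq (f := fun r t => (σ r t : OnePoint ℂ))
    (f' := fun r t => (σ' r t : OnePoint ℂ)) (b := fun r => endPoint hA e (ρ r))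
    (b' := fun r => endPoint hA e (ρ' r))
    (a := fun r => (((incEigenvalues hA r : ℝ) : ℂ) : OnePoint ℂ))
    (fun r => hcont (hσ r)) (fun r => hcont (hσ' r)) (fun r s hrs => ?_) (fun r => ?_)
    (fun r => hcoe (hst r)) hen (fun r => hcoe (hst' r)) hen' (fun r s hrs => ?_)
    (fun r s => endPoint_ne_incEigenvalues he hA r _)
    (fun r s => endPoint_ne_incEigenvalues he hA r _) ?_ (fun r s => hb _ s) (fun r s => hb _ s) r
  · rw [himg, himg]
    exact disjoint_image_of_injective OnePoint.coe_injective (hdisj r s hrs)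
  · simp only [himg, ← image_iUnion]
    refine image_mono ?_
    rw [← hun, hun']
    exact subset_iUnion (fun r => σ' r '' Ioi 0) r
  · exact he.incEigenvalues_injective hA (Complex.ofReal_injective (OnePoint.coe_injective hrs))
  · rintro r s ⟨t, ht, h⟩
    have h1 := (hσ s).im_pos t ht
    rw [OnePoint.coe_injective h] at h1
    simp at h1

theorem exists_isSpectralPermutation_forall_Icc (he : IsCyclicVector A e) (hA : A.IsSymmetric)
    {θ₁ θ₂ : ℝ} (h12 : θ₁ ≤ θ₂)
    (hreg : Icc θ₁ θ₂ ⊆ regularAngles (incEigenvalues hA) (spectralWeight hA e)) :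
    ∃ ρ, ∀ θ ∈ Icc θ₁ θ₂, IsSpectralPermutation hA e θ ρ := by
  have : Nonempty (Fin (finrank ℂ H)) :=
    ⟨⟨0, by have := finrank_orthogonal_add_one he.ne_zero; omega⟩⟩
  obtain ⟨ρ, hρ⟩ := exists_perm_forall_Icc (he.incEigenvalues_injective hA)
    (he.spectralWeight_pos hA) (poleGauge_eq_zero_iff_mem_range_endPoint he hA) h12 hreg
  refine ⟨ρ, fun θ hθ => ?_⟩
  obtain ⟨σ, h1, h2, h3, h4⟩ := hρ θ hθ
  exact ⟨σ, h1, h2, (spectralSet_eq he hA θ).trans h3, h4⟩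

theorem exists_isSpectralDecomposition (he : IsCyclicVector A e) (hA : A.IsSymmetric) :
    ∃ (T : Set ℝ) (τ : ℝ → Equiv.Perm (Fin (finrank ℂ H))), IsSpectralDecomposition hA e T τ := by
  classical
  have : Nonempty (Fin (finrank ℂ H)) :=
    ⟨⟨0, by have := finrank_orthogonal_add_one he.ne_zero; omega⟩⟩
  set G := regularAngles (incEigenvalues hA) (spectralWeight hA e) with hG
  have hmem : Ioo 0 Real.pi \ (Ioo 0 Real.pi \ G) ⊆ G := fun θ hθ => by
    by_contra h
    exact hθ.2 ⟨hθ.1, h⟩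
  -- At angles outside `G` the value of `τ` is irrelevant; the identity is used.
  have hex : ∀ θ : ℝ, ∃ ρ, θ ∈ G → IsSpectralPermutation hA e θ ρ := fun θ => by
    by_cases hθ : θ ∈ G
    · obtain ⟨ρ, hρ⟩ := exists_isSpectralPermutation_forall_Icc he hA le_rfl
        (by rw [Icc_self]; exact singleton_subset_iff.2 hθ)
      exact ⟨ρ, fun _ => hρ θ ⟨le_rfl, le_rfl⟩⟩
    · exact ⟨1, fun h => absurd h hθ⟩
  choose τ hτ using hex
  refine ⟨Ioo 0 Real.pi \ G, τ,
    finite_diff_regularAngles (he.incEigenvalues_injective hA) (he.spectralWeight_pos hA),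
    sdiff_subset, fun θ hθ ρ => ⟨fun h => (hτ θ (hmem hθ)).unique he h, fun h => ?_⟩,
    fun J hJ hJsub => ?_⟩
  · rw [h]
    exact hτ θ (hmem hθ)
  · have key : ∀ θ ∈ J, ∀ φ ∈ J, θ ≤ φ → τ θ = τ φ := fun θ hθ φ hφ hle => by
      obtain ⟨ρ, hρ⟩ := exists_isSpectralPermutation_forall_Icc he hA hle
        ((hJ.out hθ hφ).trans (hJsub.trans hmem))
      rw [(hρ θ ⟨le_rfl, hle⟩).unique he (hτ θ (hmem (hJsub hθ))),
        (hρ φ ⟨hle, le_rfl⟩).unique he (hτ φ (hmem (hJsub hφ)))]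
    intro θ hθ φ hφ
    rcases le_total θ φ with h | h
    · exact key θ hθ φ hφ h
    · exact (key φ hφ θ hθ h).symm

end Decomposition

/-! ### A two-dimensional example in which the permutation changes -/

section TwoDimensional

/-- The operator that swaps the two coordinates. -/
def swapOp : EuclideanSpace ℂ (Fin 2) →ₗ[ℂ] EuclideanSpace ℂ (Fin 2) :=
  Matrix.toEuclideanLin !![0, 1; 1, 0]

theorem swapOp_apply (f : EuclideanSpace ℂ (Fin 2)) : swapOp f = !₂[f 1, f 0] := by
  ext i
  fin_cases i <;> simp [swapOp, Matrix.toLpLin_apply, dotProduct]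

theorem swapOp_isSymmetric : swapOp.IsSymmetric := by
  intro f g
  simp [swapOp_apply, PiLp.inner_apply, Fin.sum_univ_two]
  ring

/-- The first standard basis vector of `ℂ²`. -/
def firstVector : EuclideanSpace ℂ (Fin 2) := EuclideanSpace.single 0 1

theorem isCyclicVector_swapOp : IsCyclicVector swapOp firstVector := by
  refine ⟨by simp [firstVector], ?_⟩
  rw [eq_top_iff]
  intro f _
  have h : f = f 0 • ((swapOp : Module.End ℂ _) ^ 0) firstVector +
      f 1 • ((swapOp : Module.End ℂ _) ^ 1) firstVector := by
    ext i
    fin_cases i <;> simp [firstVector, swapOp_apply]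
  rw [h]
  exact Submodule.add_mem _ (Submodule.smul_mem _ _ (Submodule.subset_span ⟨0, rfl⟩))
    (Submodule.smul_mem _ _ (Submodule.subset_span ⟨1, rfl⟩))

theorem eq_of_mem_spectrum_perturbed_swapOp {γ z : ℂ}
    (hz : z ∈ spectrum ℂ (perturbed swapOp firstVector γ : Module.End ℂ _)) :
    z * z - γ * z = 1 := by
  rw [← Module.End.hasEigenvalue_iff_mem_spectrum] at hz
  obtain ⟨f, hf⟩ := hz.exists_hasEigenvector
  have h := hf.apply_eq_smul
  have h0 := congrArg (fun g : EuclideanSpace ℂ (Fin 2) => g 0) h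
  have h1 := congrArg (fun g : EuclideanSpace ℂ (Fin 2) => g 1) h
  simp [perturbed, swapOp_apply, rankOneOp_apply, firstVector, PiLp.inner_apply] at h0 h1
  have hb : f 1 ≠ 0 := fun hb => hf.2 (by
    ext i
    fin_cases i <;> simp [hb, h1])
  refine mul_right_cancel₀ hb ?_
  rw [h1] at h0
  linear_combination -h0

theorem re_mul_normSq_sub_one_of_mem_spectralSet {θ : ℝ} {z : ℂ} (hz : z ∈ spectralSet swapOp firstVector θ) :
    ∃ t : ℝ, 0 < t ∧ z.re * (Complex.normSq z - 1) = t * Real.cos θ * Complex.normSq z := by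
  simp only [spectralSet, mem_iUnion, mem_Ioi, exists_prop] at hz
  obtain ⟨t, ht, hz⟩ := hz
  have h := eq_of_mem_spectrum_perturbed_swapOp hz
  refine ⟨t, ht, ?_⟩
  have hre := congrArg Complex.re h
  have him := congrArg Complex.im h
  simp only [Complex.sub_re, Complex.sub_im, Complex.mul_re, Complex.mul_im, Complex.ofReal_re,
    Complex.ofReal_im, Complex.exp_ofReal_mul_I_re, Complex.exp_ofReal_mul_I_im, Complex.one_re,
    Complex.one_im] at hre him
  rw [Complex.normSq_apply]
  -- This is the real part of `z² - γ z = 1` multiplied by the conjugate of `z`.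
  linear_combination z.re * hre + z.im * him

theorem truncation_swapOp_eigenvalue {δ : ℂ} (h : Module.End.HasEigenvalue
    (truncation swapOp (Submodule.span ℂ {firstVector})ᗮ) δ) : δ = 0 := by
  obtain ⟨f, hf⟩ := h.exists_hasEigenvector
  obtain ⟨c, hc⟩ := truncation_apply_eq_smul_iff.1 hf.apply_eq_smul
  have hef := Submodule.mem_orthogonal_singleton_iff_inner_right.1 f.2
  have h0 : (f : EuclideanSpace ℂ (Fin 2)) 0 = 0 := by
    simpa [firstVector, PiLp.inner_apply, Fin.sum_univ_two] using hef
  have h1 := congrArg (fun g : EuclideanSpace ℂ (Fin 2) => g 1) hc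
  simp [swapOp_apply, firstVector, h0] at h1
  refine h1.resolve_right fun hb => hf.2 (Subtype.ext ?_)
  ext i
  fin_cases i <;> simp [hb, h0]

theorem endPoint_swapOp (r : Fin (finrank ℂ (EuclideanSpace ℂ (Fin 2)))) :
    endPoint swapOp_isSymmetric firstVector r = ((0 : ℂ) : OnePoint ℂ) ∨
      endPoint swapOp_isSymmetric firstVector r = OnePoint.infty := by
  rcases (mem_range_endPoint_iff swapOp_isSymmetric isCyclicVector_swapOp).1 (mem_range_self r) with
    h | ⟨z, h, hz⟩
  · exact Or.inr h
  · exact Or.inl (by rw [h, truncation_swapOp_eigenvalue hz])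

theorem exists_incEigenvalues_swapOp_eq_one :
    ∃ r, incEigenvalues swapOp_isSymmetric r = 1 := by
  have h : Module.End.HasEigenvalue swapOp 1 := by
    refine Module.End.hasEigenvalue_of_hasEigenvector (x := !₂[1, 1])
      ⟨Module.End.mem_eigenspace_iff.2 ?_, fun h => ?_⟩
    · ext i
      fin_cases i <;> simp [swapOp_apply]
    · simpa using congrArg (fun g : EuclideanSpace ℂ (Fin 2) => g 0) h
  obtain ⟨r, hr⟩ := exists_incEigenvalues_eq swapOp_isSymmetric h
  exact ⟨r, by exact_mod_cast hr⟩

/-- A curve in `S_θ` that starts at `1` stays on one side of the unit circle. -/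
theorem IsSimpleAnalyticCurve.cos_mul_normSq_sub_one_pos {σ : ℝ → ℂ}
    (hσ : IsSimpleAnalyticCurve σ) {θ : ℝ} (hθ : Real.cos θ ≠ 0)
    (hsub : ∀ t, 0 < t → σ t ∈ spectralSet swapOp firstVector θ)
    (h1 : Tendsto σ (𝓝[>] 0) (𝓝 1)) {t : ℝ} (ht : 0 < t) :
    0 < Real.cos θ * (Complex.normSq (σ t) - 1) := by
  have hne : ∀ t, 0 < t → 0 < Real.cos θ * ((σ t).re * (Complex.normSq (σ t) - 1)) :=
    fun t ht => by
      obtain ⟨s, hs, h⟩ := re_mul_normSq_sub_one_of_mem_spectralSet (hsub t ht)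
      have h0 : 0 < Complex.normSq (σ t) := Complex.normSq_pos.2 fun h0 => by
        simpa [h0] using hσ.im_pos t ht
      rw [h, show Real.cos θ * (s * Real.cos θ * Complex.normSq (σ t)) =
        Real.cos θ ^ 2 * (s * Complex.normSq (σ t)) by ring]
      positivity
  -- The product in `hne` never vanishes, so neither does `re (σ t)`; it is positive near the start
  -- `1`, hence everywhere by connectedness.
  have hre : ∀ t, 0 < t → 0 < (σ t).re := by
    have hpre : IsPreconnected ((fun t => (σ t).re) '' Ioi 0) := isPreconnected_Ioi.image _
      (Complex.continuous_re.comp_continuousOn hσ.analytic.continuousOn)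
    have hlim : Tendsto (fun t => (σ t).re) (𝓝[>] 0) (𝓝 1) :=
      (Complex.continuous_re.tendsto 1).comp h1
    obtain ⟨t₀, ht₀, hp₀⟩ := ((hlim.eventually (lt_mem_nhds zero_lt_one)).and
      self_mem_nhdsWithin).exists
    intro t ht
    by_contra hcon
    obtain ⟨s, hs, hs0⟩ := hpre.ordConnected.out (mem_image_of_mem _ (mem_Ioi.2 ht))
      (mem_image_of_mem _ hp₀) ⟨not_lt.1 hcon, ht₀.le⟩
    have := hne s hs
    simp only [hs0, zero_mul, mul_zero, lt_irrefl] at this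
  have h2 := hne t ht
  rw [show Real.cos θ * ((σ t).re * (Complex.normSq (σ t) - 1)) =
    (σ t).re * (Real.cos θ * (Complex.normSq (σ t) - 1)) by ring] at h2
  exact (pos_iff_pos_of_mul_pos h2).1 (hre t ht)

/-- The only end points are `0` and `∞`; the curve from `1` stays outside the unit circle if `cos θ
> 0` and inside it if `cos θ < 0`, which leaves one choice. -/
theorem IsSpectralPermutation.endPoint_swapOp_eq {θ : ℝ}
    {ρ : Equiv.Perm (Fin (finrank ℂ (EuclideanSpace ℂ (Fin 2))))}
    (h : IsSpectralPermutation swapOp_isSymmetric firstVector θ ρ)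
    {r : Fin (finrank ℂ (EuclideanSpace ℂ (Fin 2)))}
    (hr : incEigenvalues swapOp_isSymmetric r = 1) :
    (0 < Real.cos θ → endPoint swapOp_isSymmetric firstVector (ρ r) = OnePoint.infty) ∧
    (Real.cos θ < 0 → endPoint swapOp_isSymmetric firstVector (ρ r) = ((0 : ℂ) : OnePoint ℂ)) := by
  obtain ⟨σ, hσ, -, hun, hst, hen⟩ := h
  have hsub : ∀ t, 0 < t → σ r t ∈ spectralSet swapOp firstVector θ := fun t ht => by
    rw [hun]
    exact mem_iUnion_of_mem r (mem_image_of_mem _ ht)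
  have h1 := hst r
  rw [hr, Complex.ofReal_one] at h1
  have hE := hen r
  constructor
  · intro hθ
    refine (endPoint_swapOp (ρ r)).resolve_left fun h0 => ?_
    rw [h0] at hE
    have hE' : Tendsto (σ r) atTop (𝓝 0) :=
      (OnePoint.isOpenEmbedding_coe.isInducing.tendsto_nhds_iff).2 hE
    have hN := (Complex.continuous_normSq.tendsto 0).comp hE'
    rw [map_zero] at hN
    obtain ⟨t, ht0, ht⟩ := ((eventually_gt_atTop (0 : ℝ)).and
      (hN.eventually (gt_mem_nhds zero_lt_one))).exists
    have := (hσ r).cos_mul_normSq_sub_one_pos hθ.ne' hsub h1 ht0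
    rw [mul_pos_iff_of_pos_left hθ, sub_pos] at this
    exact lt_asymm this ht
  · intro hθ
    refine (endPoint_swapOp (ρ r)).resolve_right fun h0 => ?_
    rw [h0] at hE
    have hE' : Tendsto (σ r) atTop (Bornology.cobounded ℂ) := by
      rw [Metric.cobounded_eq_cocompact, ← coclosedCompact_eq_cocompact,
        ← OnePoint.comap_coe_nhds_infty]
      exact tendsto_comap_iff.2 hE
    have hN := tendsto_norm_cobounded_atTop.comp hE'
    obtain ⟨t, ht0, ht⟩ := ((eventually_gt_atTop (0 : ℝ)).and
      (hN.eventually (eventually_gt_atTop 1))).exists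
    have h2 := (hσ r).cos_mul_normSq_sub_one_pos hθ.ne hsub h1 ht0
    have h3 : Complex.normSq (σ r t) - 1 < 0 := neg_of_mul_pos_right h2 hθ.le
    rw [Complex.normSq_eq_norm_sq] at h3
    have ht' : 1 < ‖σ r t‖ := ht
    nlinarith

theorem exists_perm_ne_swapOp (T : Set ℝ)
    (τ : ℝ → Equiv.Perm (Fin (finrank ℂ (EuclideanSpace ℂ (Fin 2)))))
    (h : IsSpectralDecomposition swapOp_isSymmetric firstVector T τ) :
    ∃ θ ∈ Ioo 0 Real.pi \ T, ∃ φ ∈ Ioo 0 Real.pi \ T, τ θ ≠ τ φ := by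
  have hpi := Real.pi_pos
  -- Both halves of `(0, π)` are infinite, so each contains an angle outside the finite set `T`.
  obtain ⟨θ, hθ, hθT⟩ := ((Ioo_infinite (half_pos hpi)).sdiff h.finite).nonempty
  obtain ⟨φ, hφ, hφT⟩ := ((Ioo_infinite (half_lt_self hpi)).sdiff h.finite).nonempty
  have hθ' : θ ∈ Ioo 0 Real.pi \ T := ⟨⟨hθ.1, by linarith [hθ.2]⟩, hθT⟩
  have hφ' : φ ∈ Ioo 0 Real.pi \ T := ⟨⟨by linarith [hφ.1], hφ.2⟩, hφT⟩
  refine ⟨θ, hθ', φ, hφ', fun heq => ?_⟩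
  obtain ⟨r, hr⟩ := exists_incEigenvalues_swapOp_eq_one
  have h1 := (((h.perm_iff θ hθ' _).2 rfl).endPoint_swapOp_eq hr).1
    (Real.cos_pos_of_mem_Ioo ⟨by linarith [hθ.1], hθ.2⟩)
  have h2 := (((h.perm_iff φ hφ' _).2 rfl).endPoint_swapOp_eq hr).2
    (Real.cos_neg_of_pi_div_two_lt_of_lt hφ.1 (by linarith [hφ.2]))
  rw [heq, h2] at h1
  exact OnePoint.coe_ne_infty _ h1

end TwoDimensional

end RankOnePerturbation

end

theorem mainTheorem2 :
    (∀ (H : Type*) [NormedAddCommGroup H] [InnerProductSpace ℂ H] [FiniteDimensional ℂ H]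
        (A : H →ₗ[ℂ] H) (hA : A.IsSymmetric) (e : H),
        RankOnePerturbation.IsCyclicVector A e →
          ∃ (T : Set ℝ) (τ : ℝ → Equiv.Perm (Fin (Module.finrank ℂ H))),
            RankOnePerturbation.IsSpectralDecomposition hA e T τ) ∧
    (∃ (A : EuclideanSpace ℂ (Fin 2) →ₗ[ℂ] EuclideanSpace ℂ (Fin 2)) (hA : A.IsSymmetric)
        (e : EuclideanSpace ℂ (Fin 2)),
        RankOnePerturbation.IsCyclicVector A e ∧
          ∀ (T : Set ℝ)
            (τ : ℝ → Equiv.Perm (Fin (Module.finrank ℂ (EuclideanSpace ℂ (Fin 2))))),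
            RankOnePerturbation.IsSpectralDecomposition hA e T τ →
              ∃ θ ∈ Set.Ioo 0 Real.pi \ T, ∃ φ ∈ Set.Ioo 0 Real.pi \ T, τ θ ≠ τ φ) :=
  ⟨fun _ _ _ _ _ hA _ he => RankOnePerturbation.exists_isSpectralDecomposition he hA,
    RankOnePerturbation.swapOp, RankOnePerturbation.swapOp_isSymmetric,
    RankOnePerturbation.firstVector, RankOnePerturbation.isCyclicVector_swapOp,
    RankOnePerturbation.exists_perm_ne_swapOp⟩
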